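/- **Lemma 2.4 ($L^\infty$ bound, maximum principle).** Let $\Omega\subset\mathbb R^3$ be a bounded domain with smooth boundary, let $a,b,c>0$, $\varepsilon>0$ and $T_1\in(0,\infty)$. Let $\mathcal Q=\{Q\in\mathbb R^{3\times3}: Q=Q^T,\ \operatorname{tr}Q=0\}$ with $A:B=\sum_{i,j}A_{ij}B_{ij}$ and $|A|=(A:A)^{1/2}$, and let $$F(Q)=\tfrac a2\operatorname{tr}(Q^2)-\tfrac b3\operatorname{tr}(Q^3)+\tfrac c4(\operatorname{tr}(Q^2))^2,\qquad DF(Q)=aQ-bQ^2+c|Q|^2Q+\tfrac b3|Q|^2I,\qquad F_\varepsilon=F+\varepsilon^3 .$$ Consider the Beris–Edwards system in $\Omega\times(0,T_1)$ $$\partial_t\mathbf v+(\mathbf v\cdot\nabla)\mathbf v-\Delta\mathbf v+\nabla p=-\varepsilon\operatorname{div}(\nabla Q\odot\nabla Q),\quad \operatorname{div}\mathbf v=0,\quad \partial_tQ+(\mathbf v\cdot\nabla)Q=\Delta Q-\tfrac1{\varepsilon^2}DF(Q),$$ where $(\nabla Q\odot\nabla Q)_{ij}=\partial_iQ:\partial_jQ$,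 with $\mathbf v=0$, $Q=0$ on $\partial\Omega\times(0,T_1)$ and $\mathbf v|_{t=0}=\mathbf v_{0,\varepsilon}$, $Q|_{t=0}=Q_{0,\varepsilon}$. Let $L^2_\sigma(\Omega)$ be the space of $\mathbf v\in L^2(\Omega;\mathbb R^3)$ with $\operatorname{div}\mathbf v=0$ and vanishing generalized normal trace, and let $H^1_{0,\sigma}(\Omega)$ be the space of divergence-free $\mathbf v\in H^1_0(\Omega;\mathbb R^3)$; let $BC_w([0,T];X)$ denote the bounded weakly continuous functions $[0,T]\to X$. A global weak solution on $[0,T_1]$ is a pair $(\mathbf v_\varepsilon,Q_\varepsilon)$ which attains the initial data, satisfies $Q_\varepsilon(t)\in H^1_0(\Omega;\mathcal Q)$ for $t\in(0,T_1)$, and is such that for all $T\in(0,T_1)$: (i) $\mathbf v_\varepsilon\in BC_w([0,T];L^2_\sigma(\Omega))\cap L^2(0,T;H^1_{0,\sigma}(\Omega))$ and $Q_\varepsilon\in BC_w([0,T];H^1(\Omega;\mathcal Q))\cap L^2(0,T;H^2(\Omega;\mathcal Q))$; (ii) for all $\boldsymbol\eta\in C^1([0,T];H^1_{0,\sigma}(\Omega)\cap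 W^{1,\infty}(\Omega;\mathbb R^3))$ and $\Psi\in C^1([0,T];H^1(\Omega;\mathcal Q))$, $$\int_\Omega\boldsymbol\eta\cdot\mathbf v_\varepsilon\,dx\Big|_{0}^{T}+\int_0^T\!\!\int_\Omega\big(-\partial_t\boldsymbol\eta\cdot\mathbf v_\varepsilon-\mathbf v_\varepsilon\otimes\mathbf v_\varepsilon:\nabla\boldsymbol\eta+\nabla\mathbf v_\varepsilon:\nabla\boldsymbol\eta\big)\,dx\,dt=\varepsilon\int_0^T\!\!\int_\Omega(\nabla Q_\varepsilon\odot\nabla Q_\varepsilon):\nabla\boldsymbol\eta\,dx\,dt,$$ $$\int_\Omega Q_\varepsilon:\Psi\,dx\Big|_{0}^{T}+\int_0^T\!\!\int_\Omega\big(-Q_\varepsilon:\partial_t\Psi+(\mathbf v_\varepsilon\cdot\nabla)Q_\varepsilon:\Psi\big)\,dx\,dt=\int_0^T\!\!\int_\Omega\big(\Delta Q_\varepsilon-\tfrac1{\varepsilon^2}DF(Q_\varepsilon)\big):\Psi\,dx\,dt;$$ and (iii) for almost every $T\in(0,T_1)$, with $\mathcal E(t)=\tfrac12\int_\Omega|\mathbf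 v_\varepsilon(t)|^2dx+\int_\Omega\big[\tfrac\varepsilon2|\nabla Q_\varepsilon|^2+\tfrac1\varepsilon F_\varepsilon(Q_\varepsilon)\big](t)\,dx$, $$\mathcal E(T)+\int_0^T\!\!\int_\Omega|\nabla\mathbf v_\varepsilon|^2dx\,dt+\int_0^T\!\!\int_\Omega\tfrac1\varepsilon\big|\varepsilon\Delta Q_\varepsilon-\tfrac1\varepsilon DF(Q_\varepsilon)\big|^2dx\,dt\le\mathcal E(0).$$ Let $c_0>0$ satisfy $$c_0^2\ \ge\ \max\Big\{\frac{b^2}{c^2}-\frac{2a}{c},\ \|Q_{0,\varepsilon}\|_{L^\infty(\Omega)}^2\Big\}.$$ Then every global weak solution $(\mathbf v_\varepsilon,Q_\varepsilon)$ satisfies $$\|Q_\varepsilon\|_{L^\infty(\Omega\times(0,T_1))}\le c_0 .$$ In particular the bound depends neither on time nor on $\varepsilon$, as long as $c_0$ satisfies the displayed condition. -/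

import Mathlib

open MeasureTheory Set Filter Topology
open scoped ContDiff ENNReal

noncomputable section

namespace BerisEdwards

/-- Physical space `ℝ³` with the Euclidean structure. -/
abbrev E3 := EuclideanSpace ℝ (Fin 3)

/-- Real `3 × 3` matrices. -/
abbrev Mat3 := Matrix (Fin 3) (Fin 3) ℝ

/-! ### Q-tensors and the bulk energy -/

/-- The space of symmetric traceless `3 × 3` matrices. -/
def QTensor : Set Mat3 := {A | A.transpose = A ∧ A.trace = 0}

/-- The contraction `A : B = ∑ᵢⱼ Aᵢⱼ Bᵢⱼ`. -/
def dot (A B : Mat3) : ℝ := ∑ i, ∑ j, A i j * B i j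

/-- The Frobenius norm `|A| = (A : A)^{1/2}`. -/
def frobNorm (A : Mat3) : ℝ := Real.sqrt (dot A A)

/-- The bulk energy density `F(Q) = a/2 tr(Q²) - b/3 tr(Q³) + c/4 (tr(Q²))²`. -/
def bulk (a b c : ℝ) (A : Mat3) : ℝ :=
  a / 2 * (A * A).trace - b / 3 * (A * A * A).trace + c / 4 * ((A * A).trace) ^ 2

/-- The regularised bulk energy density `F_ε = F + ε³`, which has the same gradient as `F`. -/
def bulkReg (a b c ε : ℝ) (A : Mat3) : ℝ := bulk a b c A + ε ^ 3

/-- The gradient of `F` within the space of Q-tensors: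
`DF(Q) = a Q - b Q² + c |Q|² Q + (b/3) |Q|² I`. -/
def bulkGrad (a b c : ℝ) (A : Mat3) : Mat3 :=
  a • A - b • (A * A) + (c * dot A A) • A + (b / 3 * dot A A) • (1 : Mat3)

/-! ### Domains, weak derivatives, Sobolev spaces -/

/-- Bounded domains of `ℝ³` with smooth boundary: near each boundary point, `Ω` is the sublevel set
`{φ < 0}` of a smooth function with non-vanishing derivative at that point. -/
structure IsSmoothBoundedDomain (Ω : Set E3) : Prop where
  isOpen : IsOpen Ω
  isConnected : IsConnected Ω
  isBounded : Bornology.IsBounded Ω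
  smooth_boundary : ∀ x ∈ frontier Ω, ∃ U : Set E3, IsOpen U ∧ x ∈ U ∧
    ∃ φ : E3 → ℝ, ContDiff ℝ ∞ φ ∧ fderiv ℝ φ x ≠ 0 ∧ Ω ∩ U = {y | φ y < 0} ∩ U

/-- The classical partial derivative `∂ₖ φ`. -/
def pderiv (k : Fin 3) (φ : E3 → ℝ) (x : E3) : ℝ := fderiv ℝ φ x (EuclideanSpace.single k 1)

/-- `φ ∈ C_c^∞(Ω)`. -/
structure IsTestFunction (Ω : Set E3) (φ : E3 → ℝ) : Prop where
  smooth : ContDiff ℝ ∞ φ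
  compact : HasCompactSupport φ
  subset : tsupport φ ⊆ Ω

/-- `g` is the weak partial derivative `∂ₖ u` in `Ω`. -/
structure HasWeakPartial (Ω : Set E3) (k : Fin 3) (u g : E3 → ℝ) : Prop where
  locInt : LocallyIntegrableOn u Ω
  locInt_deriv : LocallyIntegrableOn g Ω
  integral_eq : ∀ φ : E3 → ℝ, IsTestFunction Ω φ →
    ∫ x in Ω, u x * pderiv k φ x = -∫ x in Ω, g x * φ x

/-- `u ∈ L²(Ω)`. -/
def MemL2 (Ω : Set E3) (u : E3 → ℝ) : Prop := MemLp u 2 (volume.restrict Ω)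

/-- `u ∈ L^∞(Ω)`. -/
def MemLinf (Ω : Set E3) (u : E3 → ℝ) : Prop := MemLp u ∞ (volume.restrict Ω)

/-- `u ∈ H¹(Ω)` with weak gradient `Du`, where `Du x k = ∂ₖ u (x)`. -/
structure IsH1With (Ω : Set E3) (u : E3 → ℝ) (Du : E3 → Fin 3 → ℝ) : Prop where
  mem : MemL2 Ω u
  mem_grad : ∀ k, MemL2 Ω (fun x => Du x k)
  weak : ∀ k, HasWeakPartial Ω k u (fun x => Du x k)

/-- The norm of `H¹(Ω)`, in the equivalent form `‖u‖_{L²} + ∑ₖ ‖∂ₖ u‖_{L²}`. -/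
def h1Norm (Ω : Set E3) (u : E3 → ℝ) (Du : E3 → Fin 3 → ℝ) : ℝ≥0∞ :=
  eLpNorm u 2 (volume.restrict Ω) + ∑ k, eLpNorm (fun x => Du x k) 2 (volume.restrict Ω)

/-- The norm of `W^{1,∞}(Ω)`, in the equivalent form `‖u‖_{L^∞} + ∑ₖ ‖∂ₖ u‖_{L^∞}`. -/
def w1infNorm (Ω : Set E3) (u : E3 → ℝ) (Du : E3 → Fin 3 → ℝ) : ℝ≥0∞ :=
  eLpNorm u ∞ (volume.restrict Ω) + ∑ k, eLpNorm (fun x => Du x k) ∞ (volume.restrict Ω)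

/-- `u ∈ H¹₀(Ω)`, the closure of `C_c^∞(Ω)` in `H¹(Ω)` (equivalently, for smooth bounded `Ω`, the
functions in `H¹(Ω)` with vanishing trace), with weak gradient `Du`. -/
structure IsH10With (Ω : Set E3) (u : E3 → ℝ) (Du : E3 → Fin 3 → ℝ) : Prop where
  isH1 : IsH1With Ω u Du
  approx : ∃ φ : ℕ → E3 → ℝ, (∀ n, IsTestFunction Ω (φ n)) ∧
    Tendsto (fun n => h1Norm Ω (fun x => u x - φ n x) (fun x k => Du x k - pderiv k (φ n) x))
      atTop (𝓝 0)

/-- `w ∈ L²_σ(Ω)`: square integrable fields with `div w = 0` in the sense of distributions and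
vanishing generalised normal trace `γ(w)`. The latter is the functional on traces of functions
`φ ∈ H¹(Ω)` given by `⟨γ(w), φ⟩ = ∫_Ω w · ∇φ + ∫_Ω (div w) φ`. -/
structure IsL2Sigma (Ω : Set E3) (w : E3 → E3) : Prop where
  mem : ∀ i, MemL2 Ω (fun x => w x i)
  div_eq_zero : ∀ φ : E3 → ℝ, IsTestFunction Ω φ → ∫ x in Ω, ∑ i, w x i * pderiv i φ x = 0
  normal_trace : ∀ (φ : E3 → ℝ) (Dφ : E3 → Fin 3 → ℝ), IsH1With Ω φ Dφ →
    ∫ x in Ω, ∑ i, w x i * Dφ x i = 0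

/-- `w ∈ H¹_{0,σ}(Ω)` with weak gradient `Dw`, where `Dw x i k = ∂ₖ wᵢ (x)`. -/
structure IsH10SigmaWith (Ω : Set E3) (w : E3 → E3) (Dw : E3 → Mat3) : Prop where
  isH10 : ∀ i, IsH10With Ω (fun x => w x i) (fun x => Dw x i)
  div_eq_zero : ∀ᵐ x ∂(volume.restrict Ω), ∑ i, Dw x i i = 0

/-! ### Spaces of time dependent functions -/

/-- `v ∈ BC_w([0,T]; L²_σ(Ω))`. -/
structure IsBCwL2Sigma (Ω : Set E3) (T : ℝ) (v : ℝ → E3 → E3) : Prop where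
  mem : ∀ t ∈ Icc 0 T, IsL2Sigma Ω (v t)
  bounded : ∃ C : ℝ, ∀ t ∈ Icc 0 T, ∀ i,
    eLpNorm (fun x => v t x i) 2 (volume.restrict Ω) ≤ ENNReal.ofReal C
  weak_cont : ∀ w : E3 → E3, (∀ i, MemL2 Ω (fun x => w x i)) →
    ContinuousOn (fun t => ∫ x in Ω, ∑ i, v t x i * w x i) (Icc 0 T)

/-- `u ∈ BC_w([0,T]; H¹(Ω))`, with weak gradients `Du t`. The continuous linear functionals on
`H¹(Ω)` are the maps `u ↦ ∫ u f + ∑ₖ ∫ ∂ₖu gₖ` with `f, gₖ ∈ L²(Ω)`. -/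
structure IsBCwH1 (Ω : Set E3) (T : ℝ) (u : ℝ → E3 → ℝ) (Du : ℝ → E3 → Fin 3 → ℝ) : Prop where
  mem : ∀ t ∈ Icc 0 T, IsH1With Ω (u t) (Du t)
  bounded : ∃ C : ℝ, ∀ t ∈ Icc 0 T, h1Norm Ω (u t) (Du t) ≤ ENNReal.ofReal C
  weak_cont : ∀ (f : E3 → ℝ) (g : E3 → Fin 3 → ℝ), MemL2 Ω f → (∀ k, MemL2 Ω (fun x => g x k)) →
    ContinuousOn
      (fun t => (∫ x in Ω, u t x * f x) + ∑ k, ∫ x in Ω, Du t x k * g x k) (Icc 0 T)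

/-- `u ∈ L²(Ω × (0,T))`, as a jointly measurable function; this is `L²(0,T; L²(Ω))`. -/
def MemL2L2 (Ω : Set E3) (T : ℝ) (u : ℝ → E3 → ℝ) : Prop :=
  MemLp (fun p : E3 × ℝ => u p.2 p.1) 2 (volume.restrict (Ω ×ˢ Ioo 0 T))

/-- `v ∈ L²(0,T; H¹_{0,σ}(Ω))`, with weak spatial gradients `Dv t`. -/
structure IsL2H10Sigma (Ω : Set E3) (T : ℝ) (v : ℝ → E3 → E3) (Dv : ℝ → E3 → Mat3) : Prop where
  mem : ∀ i, MemL2L2 Ω T (fun t x => v t x i)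
  mem_grad : ∀ i k, MemL2L2 Ω T (fun t x => Dv t x i k)
  slice : ∀ᵐ t ∂(volume.restrict (Ioo 0 T)), IsH10SigmaWith Ω (v t) (Dv t)

/-- `u ∈ L²(0,T; H²(Ω))`, with weak spatial derivatives `Du t x k = ∂ₖ u` and
`D2u t x k l = ∂ₗ ∂ₖ u`. -/
structure IsL2H2 (Ω : Set E3) (T : ℝ) (u : ℝ → E3 → ℝ) (Du : ℝ → E3 → Fin 3 → ℝ)
    (D2u : ℝ → E3 → Fin 3 → Fin 3 → ℝ) : Prop where
  mem : MemL2L2 Ω T u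
  mem_grad : ∀ k, MemL2L2 Ω T (fun t x => Du t x k)
  mem_hess : ∀ k l, MemL2L2 Ω T (fun t x => D2u t x k l)
  slice : ∀ᵐ t ∂(volume.restrict (Ioo 0 T)),
    IsH1With Ω (u t) (Du t) ∧ ∀ k, IsH1With Ω (fun x => Du t x k) (fun x => D2u t x k)

/-- The curve `t ↦ u t` is `C¹` on `[0,T]` with derivative `t ↦ ut t`, with respect to the norm `N`
(a function of `u` and of its weak gradient). -/
structure IsC1Curve (N : (E3 → ℝ) → (E3 → Fin 3 → ℝ) → ℝ≥0∞) (T : ℝ)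
    (u : ℝ → E3 → ℝ) (Du : ℝ → E3 → Fin 3 → ℝ)
    (ut : ℝ → E3 → ℝ) (Dut : ℝ → E3 → Fin 3 → ℝ) : Prop where
  hasDeriv : ∀ t ∈ Icc 0 T, Tendsto
    (fun s => N (fun x => (s - t)⁻¹ * (u s x - u t x) - ut t x)
      (fun x k => (s - t)⁻¹ * (Du s x k - Du t x k) - Dut t x k))
    (𝓝[Icc 0 T \ {t}] t) (𝓝 0)
  cont_deriv : ∀ t ∈ Icc 0 T, Tendsto
    (fun s => N (fun x => ut s x - ut t x) (fun x k => Dut s x k - Dut t x k))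
    (𝓝[Icc 0 T] t) (𝓝 0)

/-- Admissible test fields for the momentum equation:
`η ∈ C¹([0,T]; H¹_{0,σ}(Ω) ∩ W^{1,∞}(Ω; ℝ³))`, with gradient `Dη`, time derivative `ηt` and
`Dηt = ∇∂ₜη`. -/
structure IsVelocityTest (Ω : Set E3) (T : ℝ) (η : ℝ → E3 → E3) (Dη : ℝ → E3 → Mat3)
    (ηt : ℝ → E3 → E3) (Dηt : ℝ → E3 → Mat3) : Prop where
  mem : ∀ t ∈ Icc 0 T, IsH10SigmaWith Ω (η t) (Dη t)
  mem_deriv : ∀ t ∈ Icc 0 T, IsH10SigmaWith Ω (ηt t) (Dηt t)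
  mem_inf : ∀ t ∈ Icc 0 T, ∀ i, MemLinf Ω (fun x => η t x i) ∧
    ∀ k, MemLinf Ω (fun x => Dη t x i k)
  mem_inf_deriv : ∀ t ∈ Icc 0 T, ∀ i, MemLinf Ω (fun x => ηt t x i) ∧
    ∀ k, MemLinf Ω (fun x => Dηt t x i k)
  c1 : ∀ i, IsC1Curve (fun u Du => h1Norm Ω u Du + w1infNorm Ω u Du) T
    (fun t x => η t x i) (fun t x => Dη t x i) (fun t x => ηt t x i) (fun t x => Dηt t x i)

/-- Admissible test fields for the Q-tensor equation: `Ψ ∈ C¹([0,T]; H¹(Ω; 𝒬))`, where `𝒬` is the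
space of Q-tensors, with gradient `DΨ t x i j k = ∂ₖ Ψᵢⱼ`, time derivative `Ψt` and `DΨt = ∇∂ₜΨ`. -/
structure IsTensorTest (Ω : Set E3) (T : ℝ) (Ψ : ℝ → E3 → Mat3)
    (DΨ : ℝ → E3 → Fin 3 → Fin 3 → Fin 3 → ℝ) (Ψt : ℝ → E3 → Mat3)
    (DΨt : ℝ → E3 → Fin 3 → Fin 3 → Fin 3 → ℝ) : Prop where
  tensor : ∀ t ∈ Icc 0 T, ∀ᵐ x ∂(volume.restrict Ω), Ψ t x ∈ QTensor
  tensor_deriv : ∀ t ∈ Icc 0 T, ∀ᵐ x ∂(volume.restrict Ω), Ψt t x ∈ QTensor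
  mem : ∀ t ∈ Icc 0 T, ∀ i j, IsH1With Ω (fun x => Ψ t x i j) (fun x => DΨ t x i j)
  mem_deriv : ∀ t ∈ Icc 0 T, ∀ i j, IsH1With Ω (fun x => Ψt t x i j) (fun x => DΨt t x i j)
  c1 : ∀ i j, IsC1Curve (h1Norm Ω) T
    (fun t x => Ψ t x i j) (fun t x => DΨ t x i j) (fun t x => Ψt t x i j) (fun t x => DΨt t x i j)

/-! ### Weak solutions of the Beris–Edwards system -/

/-- `(∇Q ⊙ ∇Q)ₖₗ = ∂ₖQ : ∂ₗQ`, in terms of the gradient `D i j k = ∂ₖ Qᵢⱼ` at a point. -/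
def ericksen (D : Fin 3 → Fin 3 → Fin 3 → ℝ) : Mat3 :=
  fun k l => ∑ i, ∑ j, D i j k * D i j l

/-- `|∇Q|²`, in terms of the gradient at a point. -/
def gradSq (D : Fin 3 → Fin 3 → Fin 3 → ℝ) : ℝ := ∑ i, ∑ j, ∑ k, D i j k ^ 2

/-- `(v · ∇) Q`, in terms of the gradient at a point. -/
def advect (v : E3) (D : Fin 3 → Fin 3 → Fin 3 → ℝ) : Mat3 :=
  fun i j => ∑ k, v k * D i j k

/-- `ΔQ`, in terms of the second derivatives at a point. -/
def lap (D2 : Fin 3 → Fin 3 → Fin 3 → Fin 3 → ℝ) : Mat3 :=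
  fun i j => ∑ k, D2 i j k k

/-- The momentum equation on `[0,T]`, tested with `η`. -/
def MomentumIdentity (Ω : Set E3) (ε T : ℝ) (v : ℝ → E3 → E3) (Dv : ℝ → E3 → Mat3)
    (DQ : ℝ → E3 → Fin 3 → Fin 3 → Fin 3 → ℝ)
    (η : ℝ → E3 → E3) (Dη : ℝ → E3 → Mat3) (ηt : ℝ → E3 → E3) : Prop :=
  ((∫ x in Ω, ∑ i, η T x i * v T x i) - ∫ x in Ω, ∑ i, η 0 x i * v 0 x i)
    + (∫ t in (0 : ℝ)..T, ∫ x in Ω,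
        (-(∑ i, ηt t x i * v t x i) - ∑ i, ∑ k, v t x i * v t x k * Dη t x i k))
    + (∫ t in (0 : ℝ)..T, ∫ x in Ω, dot (Dv t x) (Dη t x))
  = ε * ∫ t in (0 : ℝ)..T, ∫ x in Ω, dot (ericksen (DQ t x)) (Dη t x)

/-- The Q-tensor equation on `[0,T]`, tested with `Ψ`. -/
def TensorIdentity (Ω : Set E3) (a b c ε T : ℝ) (v : ℝ → E3 → E3) (Q : ℝ → E3 → Mat3)
    (DQ : ℝ → E3 → Fin 3 → Fin 3 → Fin 3 → ℝ)
    (D2Q : ℝ → E3 → Fin 3 → Fin 3 → Fin 3 → Fin 3 → ℝ)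
    (Ψ Ψt : ℝ → E3 → Mat3) : Prop :=
  ((∫ x in Ω, dot (Q T x) (Ψ T x)) - ∫ x in Ω, dot (Q 0 x) (Ψ 0 x))
    - (∫ t in (0 : ℝ)..T, ∫ x in Ω, dot (Q t x) (Ψt t x))
    + (∫ t in (0 : ℝ)..T, ∫ x in Ω, dot (advect (v t x) (DQ t x)) (Ψ t x))
  = ∫ t in (0 : ℝ)..T, ∫ x in Ω,
      dot (lap (D2Q t x) - (1 / ε ^ 2) • bulkGrad a b c (Q t x)) (Ψ t x)

/-- The total energy `½ ∫ |v|² + ∫ (ε/2 |∇Q|² + ε⁻¹ F_ε(Q))` at time `t`. -/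
def energy (Ω : Set E3) (a b c ε : ℝ) (v : ℝ → E3 → E3) (Q : ℝ → E3 → Mat3)
    (DQ : ℝ → E3 → Fin 3 → Fin 3 → Fin 3 → ℝ) (t : ℝ) : ℝ :=
  1 / 2 * (∫ x in Ω, ‖v t x‖ ^ 2)
    + ∫ x in Ω, (ε / 2 * gradSq (DQ t x) + 1 / ε * bulkReg a b c ε (Q t x))

/-- The energy dissipated on `[0,T]`: `∫∫ |∇v|² + ∫∫ ε⁻¹ |ε ΔQ - ε⁻¹ DF_ε(Q)|²`. -/
def dissipation (Ω : Set E3) (a b c ε : ℝ) (Dv : ℝ → E3 → Mat3) (Q : ℝ → E3 → Mat3)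
    (D2Q : ℝ → E3 → Fin 3 → Fin 3 → Fin 3 → Fin 3 → ℝ) (T : ℝ) : ℝ :=
  (∫ t in (0 : ℝ)..T, ∫ x in Ω, frobNorm (Dv t x) ^ 2)
    + ∫ t in (0 : ℝ)..T, ∫ x in Ω,
        1 / ε * frobNorm (ε • lap (D2Q t x) - (1 / ε) • bulkGrad a b c (Q t x)) ^ 2

/-- `(v, Q)` is a global weak solution on `[0,T₁]` of the Beris–Edwards system in `Ω` with initial
data `(v₀, Q₀)` and homogeneous Dirichlet conditions, the weak derivatives being
`Dv t x i k = ∂ₖ vᵢ`, `DQ t x i j k = ∂ₖ Qᵢⱼ` and `D2Q t x i j k l = ∂ₗ ∂ₖ Qᵢⱼ`. The condition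
`v = 0` on the boundary is contained in `regularity_v`. -/
structure IsWeakSolutionWith (Ω : Set E3) (a b c ε T₁ : ℝ) (v₀ : E3 → E3) (Q₀ : E3 → Mat3)
    (v : ℝ → E3 → E3) (Dv : ℝ → E3 → Mat3) (Q : ℝ → E3 → Mat3)
    (DQ : ℝ → E3 → Fin 3 → Fin 3 → Fin 3 → ℝ)
    (D2Q : ℝ → E3 → Fin 3 → Fin 3 → Fin 3 → Fin 3 → ℝ) : Prop where
  regularity_v : ∀ T ∈ Ioo 0 T₁, IsBCwL2Sigma Ω T v ∧ IsL2H10Sigma Ω T v Dv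
  tensor : ∀ t ∈ Ico 0 T₁, ∀ᵐ x ∂(volume.restrict Ω), Q t x ∈ QTensor
  regularity_Q : ∀ T ∈ Ioo 0 T₁, ∀ i j,
    IsBCwH1 Ω T (fun t x => Q t x i j) (fun t x => DQ t x i j) ∧
    IsL2H2 Ω T (fun t x => Q t x i j) (fun t x => DQ t x i j) (fun t x => D2Q t x i j)
  boundary_Q : ∀ t ∈ Ioo 0 T₁, ∀ i j, IsH10With Ω (fun x => Q t x i j) (fun x => DQ t x i j)
  initial_v : v 0 =ᵐ[volume.restrict Ω] v₀
  initial_Q : Q 0 =ᵐ[volume.restrict Ω] Q₀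
  momentum : ∀ T ∈ Ioo 0 T₁, ∀ η Dη ηt Dηt, IsVelocityTest Ω T η Dη ηt Dηt →
    MomentumIdentity Ω ε T v Dv DQ η Dη ηt
  tensor_eq : ∀ T ∈ Ioo 0 T₁, ∀ Ψ DΨ Ψt DΨt, IsTensorTest Ω T Ψ DΨ Ψt DΨt →
    TensorIdentity Ω a b c ε T v Q DQ D2Q Ψ Ψt
  energy_ineq : ∀ᵐ T ∂(volume.restrict (Ioo 0 T₁)),
    energy Ω a b c ε v Q DQ T + dissipation Ω a b c ε Dv Q D2Q T ≤ energy Ω a b c ε v Q DQ 0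

/-- `(v, Q)` is a global weak solution on `[0,T₁]` of the Beris–Edwards system. -/
def IsWeakSolution (Ω : Set E3) (a b c ε T₁ : ℝ) (v₀ : E3 → E3) (Q₀ : E3 → Mat3)
    (v : ℝ → E3 → E3) (Q : ℝ → E3 → Mat3) : Prop :=
  ∃ Dv DQ D2Q, IsWeakSolutionWith Ω a b c ε T₁ v₀ Q₀ v Dv Q DQ D2Q

end BerisEdwards

end

noncomputable section

namespace BerisEdwards

/-! ### A smooth convex penalty of linear growth -/

section Penalty

/-! The bound is a maximum principle in integrated form. Let `Φ` be a smooth convex function of `Q`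
that depends only on `|Q|` and vanishes exactly on the ball of radius `c₀`. Then `∇Φ(Q) = m(Q) Q`
with `m ≥ 0`, and formally `d/dt ∫ Φ(Q) = ∫ m(Q) Q : (ΔQ - ε⁻² DF(Q) - (v · ∇)Q)`. The transport
term is `∫ v · ∇Φ(Q) = 0` because `v` is solenoidal (`integral_transport_penalty_eq_zero`). The
diffusion term is minus the Hessian of `Φ` applied to `∇Q`, hence nonpositive by convexity
(`integral_laplacian_penalty_nonpos`). For the bulk term, `Q : DF(Q) ≥ |Q|² (a - b|Q| + c|Q|²)`, and
the condition on `c₀` makes the bracket nonnegative wherever `|Q| ≥ c₀`, while `m = 0` elsewhere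
(`dot_bulkGrad_nonneg`). So `∫ Φ(Q(T)) ≤ ∫ Φ(Q₀) = 0`, which forces `|Q(T)| ≤ c₀` almost everywhere.

The regularity available dictates the choice of `Φ`. The product `(v · ∇)Q` is controlled only in
`L¹`, so `∇Φ` has to be bounded: `Φ` grows linearly. It is built from `√(1 + |Q|²)`, which is smooth
at the origin, followed by a smooth nondecreasing convex `ramp`; its Hessian is bounded as well, so
the integrations by parts survive approximation by test functions.

The formal time derivative is justified pointwise in space. Time-independent test tensors give `Q(T)
- Q(0) = ∫₀ᵀ (rate)` for almost every `x` (`ae_vec_eq`), and a chain rule for Lipschitz functions of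
an indefinite integral follows (`ae_sub_eq_integral_fderiv`). The rate is integrable because `H¹₀ ⊂
L³` controls the cubic term of `DF`. -/

/-- A smooth convex primitive of `Real.smoothTransition`, vanishing on `(-∞, 0]`. -/
def ramp (x : ℝ) : ℝ := ∫ t in (0 : ℝ)..x, Real.smoothTransition t

lemma hasDerivAt_ramp (x : ℝ) : HasDerivAt ramp (Real.smoothTransition x) x :=
  intervalIntegral.integral_hasDerivAt_right
    (Real.smoothTransition.continuous.intervalIntegrable _ _)
    (Real.smoothTransition.continuous.stronglyMeasurableAtFilter _ _)
    Real.smoothTransition.continuous.continuousAt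

lemma deriv_ramp : deriv ramp = Real.smoothTransition :=
  funext fun x => (hasDerivAt_ramp x).deriv

lemma contDiff_ramp : ContDiff ℝ ∞ ramp := by
  rw [contDiff_infty_iff_deriv, deriv_ramp]
  exact ⟨fun x => (hasDerivAt_ramp x).differentiableAt, Real.smoothTransition.contDiff⟩

lemma ramp_of_nonpos {x : ℝ} (hx : x ≤ 0) : ramp x = 0 := by
  rw [ramp, intervalIntegral.integral_congr (g := fun _ => (0 : ℝ))]
  · simp
  · intro t ht
    rw [uIcc_of_ge hx] at ht
    exact Real.smoothTransition.zero_of_nonpos ht.2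

lemma ramp_pos {x : ℝ} (hx : 0 < x) : 0 < ramp x := by
  refine intervalIntegral.intervalIntegral_pos_of_pos_on
    (Real.smoothTransition.continuous.intervalIntegrable _ _) (fun t ht => ?_) hx
  exact Real.smoothTransition.pos_of_pos ht.1

lemma ramp_nonneg (x : ℝ) : 0 ≤ ramp x := by
  rcases le_or_gt x 0 with h | h
  · rw [ramp_of_nonpos h]
  · exact (ramp_pos h).le

lemma exists_abs_deriv_smoothTransition_le :
    ∃ C : ℝ, 0 ≤ C ∧ ∀ x, |deriv Real.smoothTransition x| ≤ C := by
  have hcont : Continuous (deriv Real.smoothTransition) :=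
    (Real.smoothTransition.contDiff (n := 1)).continuous_deriv le_rfl
  have hsupp : HasCompactSupport (deriv Real.smoothTransition) := by
    refine HasCompactSupport.intro (isCompact_Icc (a := (0 : ℝ)) (b := 1)) fun x hx => ?_
    rw [mem_Icc, not_and_or, not_le, not_le] at hx
    rcases hx with h | h
    · have : Real.smoothTransition =ᶠ[𝓝 x] fun _ => 0 := by
        filter_upwards [Iio_mem_nhds h] with y hy
        exact Real.smoothTransition.zero_of_nonpos (le_of_lt hy)
      rw [this.deriv_eq, deriv_const]
    · have : Real.smoothTransition =ᶠ[𝓝 x] fun _ => 1 := by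
        filter_upwards [Ioi_mem_nhds h] with y hy
        exact Real.smoothTransition.one_of_one_le (le_of_lt hy)
      rw [this.deriv_eq, deriv_const]
  obtain ⟨C, hC⟩ := hcont.bounded_above_of_compact_support hsupp
  exact ⟨C, (norm_nonneg _).trans (hC 0), hC⟩

lemma deriv_smoothTransition_nonneg (x : ℝ) : 0 ≤ deriv Real.smoothTransition x :=
  Real.smoothTransition.monotone.deriv_nonneg

variable {E : Type*} [NormedAddCommGroup E]

/-- The Japanese bracket `√(1 + |y|²)`. -/
def bracket (y : E) : ℝ := Real.sqrt (1 + ‖y‖ ^ 2)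

lemma bracket_sq (y : E) : bracket y ^ 2 = 1 + ‖y‖ ^ 2 := Real.sq_sqrt (by positivity)

lemma bracket_pos (y : E) : 0 < bracket y := Real.sqrt_pos.2 (by positivity)

lemma one_le_bracket (y : E) : 1 ≤ bracket y := by
  rw [bracket, Real.one_le_sqrt]; nlinarith [sq_nonneg ‖y‖]

lemma norm_le_bracket (y : E) : ‖y‖ ≤ bracket y := Real.le_sqrt_of_sq_le (by linarith)

lemma bracket_le_iff {c₀ : ℝ} (hc₀ : 0 ≤ c₀) (y : E) :
    bracket y ≤ Real.sqrt (1 + c₀ ^ 2) ↔ ‖y‖ ≤ c₀ := by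
  rw [bracket, Real.sqrt_le_sqrt_iff (by positivity), add_le_add_iff_left,
    sq_le_sq₀ (norm_nonneg _) hc₀]

/-- The penalty `θ(√(1 + |y|²) - √(1 + c₀²))` with `θ = ramp`, which vanishes exactly on the ball
of radius `c₀`. -/
def penalty (c₀ : ℝ) (y : E) : ℝ := ramp (bracket y - Real.sqrt (1 + c₀ ^ 2))

/-- The factor `m` in `∇(penalty)(y) = m(y) y`. -/
def penaltyCoef (c₀ : ℝ) (y : E) : ℝ :=
  Real.smoothTransition (bracket y - Real.sqrt (1 + c₀ ^ 2)) / bracket y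

/-- The factor `κ` in `∇m(y) = κ(y) y`, where `m` is `penaltyCoef`. -/
def penaltyCurv (c₀ : ℝ) (y : E) : ℝ :=
  (deriv Real.smoothTransition (bracket y - Real.sqrt (1 + c₀ ^ 2)) / bracket y
    - Real.smoothTransition (bracket y - Real.sqrt (1 + c₀ ^ 2)) / bracket y ^ 2) / bracket y

lemma penaltyCoef_eq_zero {c₀ : ℝ} (hc₀ : 0 ≤ c₀) {y : E} (hy : ‖y‖ ≤ c₀) :
    penaltyCoef c₀ y = 0 := by
  rw [penaltyCoef, Real.smoothTransition.zero_of_nonpos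
    (sub_nonpos.2 ((bracket_le_iff hc₀ y).2 hy)), zero_div]

lemma penalty_eq_zero_iff {c₀ : ℝ} (hc₀ : 0 ≤ c₀) (y : E) : penalty c₀ y = 0 ↔ ‖y‖ ≤ c₀ := by
  rw [← bracket_le_iff hc₀]
  refine ⟨fun h => ?_, fun h => ramp_of_nonpos (sub_nonpos.2 h)⟩
  by_contra hlt
  exact (ramp_pos (sub_pos.2 (not_le.1 hlt))).ne' h

variable (c₀ : ℝ)

lemma penaltyCoef_nonneg (y : E) : 0 ≤ penaltyCoef c₀ y :=
  div_nonneg (Real.smoothTransition.nonneg _) (bracket_pos y).le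

lemma penaltyCoef_le_one (y : E) : penaltyCoef c₀ y ≤ 1 :=
  (div_le_one (bracket_pos y)).2 ((Real.smoothTransition.le_one _).trans (one_le_bracket y))

/-- This is the linear growth of the penalty: its gradient has norm at most one, so it can be paired
with a rate that is merely integrable. -/
lemma penaltyCoef_mul_norm_le (y : E) : penaltyCoef c₀ y * ‖y‖ ≤ 1 := by
  rw [penaltyCoef, div_mul_eq_mul_div, div_le_one (bracket_pos y)]
  calc _ ≤ 1 * ‖y‖ := by gcongr; exact Real.smoothTransition.le_one _
    _ ≤ _ := by rw [one_mul]; exact norm_le_bracket y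

/-- With `r = √(1 + |y|²)`, the curvature factor is at most `(C / r + 1 / r²) / r`, and `|y| ≤ r`
absorbs the two powers of `y`. Together with `penaltyCoef_le_one` this bounds the Hessian of the
penalty. -/
lemma exists_abs_penaltyCurv_mul_le :
    ∃ C : ℝ, 0 ≤ C ∧ ∀ y : E, |penaltyCurv c₀ y| * ‖y‖ ^ 2 ≤ C := by
  obtain ⟨C, hC0, hC⟩ := exists_abs_deriv_smoothTransition_le
  refine ⟨C + 1, by positivity, fun y => ?_⟩
  set r := bracket y with hr
  have hr1 : 1 ≤ r := one_le_bracket y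
  have hr0 : 0 < r := bracket_pos y
  have hy2 : ‖y‖ ^ 2 ≤ r ^ 2 := by rw [hr, bracket_sq]; linarith
  set s := r - Real.sqrt (1 + c₀ ^ 2)
  have hk : |penaltyCurv c₀ y| ≤ (C / r + 1 / r ^ 2) / r := by
    rw [penaltyCurv, abs_div, abs_of_pos hr0]
    gcongr
    refine (abs_sub _ _).trans ?_
    rw [abs_div, abs_div, abs_of_pos hr0, abs_of_pos (pow_pos hr0 2)]
    gcongr
    · exact hC _
    · rw [abs_of_nonneg (Real.smoothTransition.nonneg _)]
      exact Real.smoothTransition.le_one _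
  calc |penaltyCurv c₀ y| * ‖y‖ ^ 2 ≤ (C / r + 1 / r ^ 2) / r * r ^ 2 := by gcongr
    _ = C + 1 / r := by field_simp
    _ ≤ C + 1 := by
      gcongr
      exact (div_le_one hr0).2 hr1

variable [InnerProductSpace ℝ E]

lemma contDiff_bracket : ContDiff ℝ ∞ (bracket : E → ℝ) := by
  unfold bracket
  exact ContDiff.sqrt (contDiff_const.add (contDiff_norm_sq ℝ)) fun y => by positivity

lemma hasFDerivAt_bracket (y : E) :
    HasFDerivAt (bracket : E → ℝ) ((bracket y)⁻¹ • innerSL ℝ y) y := by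
  have h1 : HasFDerivAt (fun y : E => 1 + ‖y‖ ^ 2) (2 • innerSL ℝ y) y :=
    (hasStrictFDerivAt_norm_sq y).hasFDerivAt.const_add 1
  refine (h1.sqrt (by positivity : 1 + ‖y‖ ^ 2 ≠ 0)).congr_fderiv ?_
  have hp := (bracket_pos y).ne'
  ext h
  simp only [smul_apply, smul_eq_mul, nsmul_eq_mul, innerSL_apply_apply]
  rw [← bracket]
  field_simp
  simp

lemma contDiff_penalty : ContDiff ℝ ∞ (penalty c₀ : E → ℝ) :=
  contDiff_ramp.comp (contDiff_bracket.sub contDiff_const)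

lemma contDiff_penaltyCoef : ContDiff ℝ ∞ (penaltyCoef c₀ : E → ℝ) :=
  (Real.smoothTransition.contDiff.comp (contDiff_bracket.sub contDiff_const)).div
    contDiff_bracket fun y => (bracket_pos y).ne'

lemma continuous_penaltyCurv : Continuous (penaltyCurv c₀ : E → ℝ) := by
  have hb : Continuous (bracket : E → ℝ) := contDiff_bracket.continuous
  have h1 : Continuous (deriv Real.smoothTransition) :=
    (Real.smoothTransition.contDiff (n := 1)).continuous_deriv le_rfl
  have h2 := Real.smoothTransition.continuous
  have hne : ∀ y : E, bracket y ≠ 0 := fun y => (bracket_pos y).ne'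
  unfold penaltyCurv
  exact (((h1.comp (hb.sub continuous_const)).div hb hne).sub
    ((h2.comp (hb.sub continuous_const)).div (hb.pow 2) fun y => pow_ne_zero 2 (hne y))).div hb hne

lemma hasFDerivAt_penalty (y : E) :
    HasFDerivAt (penalty c₀ : E → ℝ) (penaltyCoef c₀ y • innerSL ℝ y) y := by
  refine ((hasDerivAt_ramp (bracket y - Real.sqrt (1 + c₀ ^ 2))).comp_hasFDerivAt y
    ((hasFDerivAt_bracket y).sub_const (Real.sqrt (1 + c₀ ^ 2)))).congr_fderiv ?_
  rw [smul_smul, penaltyCoef, div_eq_mul_inv]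

lemma hasFDerivAt_penaltyCoef (y : E) :
    HasFDerivAt (penaltyCoef c₀ : E → ℝ) (penaltyCurv c₀ y • innerSL ℝ y) y := by
  have hd : HasDerivAt Real.smoothTransition
      (deriv Real.smoothTransition (bracket y - Real.sqrt (1 + c₀ ^ 2)))
      (bracket y - Real.sqrt (1 + c₀ ^ 2)) :=
    ((Real.smoothTransition.contDiff (n := 1)).differentiable one_ne_zero _).hasDerivAt
  have hp := (bracket_pos y).ne'
  have hq := (hd.comp_sub_const (bracket y) (Real.sqrt (1 + c₀ ^ 2))).div
    (hasDerivAt_id (bracket y)) hp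
  refine (hq.comp_hasFDerivAt y (hasFDerivAt_bracket y)).congr_fderiv ?_
  rw [smul_smul, penaltyCurv]
  congr 1
  simp only [id]
  field_simp

/-- Convexity of the penalty: its Hessian is positive semidefinite. -/
lemma penalty_hessian_nonneg (y h : E) :
    0 ≤ penaltyCoef c₀ y * ‖h‖ ^ 2 + penaltyCurv c₀ y * inner ℝ y h ^ 2 := by
  have hr0 : 0 < bracket y := bracket_pos y
  have hin : inner ℝ y h ^ 2 ≤ bracket y ^ 2 * ‖h‖ ^ 2 := by
    rw [← mul_pow]
    refine sq_le_sq.2 ?_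
    rw [abs_of_nonneg (mul_nonneg hr0.le (norm_nonneg h))]
    exact (abs_real_inner_le_norm y h).trans (by gcongr; exact norm_le_bracket y)
  have h1 := Real.smoothTransition.nonneg (bracket y - Real.sqrt (1 + c₀ ^ 2))
  have h2 := deriv_smoothTransition_nonneg (bracket y - Real.sqrt (1 + c₀ ^ 2))
  rw [penaltyCoef, penaltyCurv]
  generalize bracket y = r at *
  generalize Real.smoothTransition (r - Real.sqrt (1 + c₀ ^ 2)) = T at *
  generalize deriv Real.smoothTransition (r - Real.sqrt (1 + c₀ ^ 2)) = T' at *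
  -- The Hessian splits into a tangential part, nonnegative by Cauchy–Schwarz and `‖y‖ ≤ r`, and a
  -- radial part, nonnegative since the transition is monotone.
  have : T / r * ‖h‖ ^ 2 + (T' / r - T / r ^ 2) / r * inner ℝ y h ^ 2
      = T / r ^ 3 * (r ^ 2 * ‖h‖ ^ 2 - inner ℝ y h ^ 2) + T' / r ^ 2 * inner ℝ y h ^ 2 := by
    field_simp
    ring
  rw [this]
  have := sub_nonneg.2 hin
  positivity

lemma abs_fderiv_penalty_apply_le (y h : E) : |penaltyCoef c₀ y * inner ℝ y h| ≤ ‖h‖ := by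
  rw [abs_mul, abs_of_nonneg (penaltyCoef_nonneg c₀ y)]
  calc _ ≤ penaltyCoef c₀ y * (‖y‖ * ‖h‖) := by
        gcongr
        · exact penaltyCoef_nonneg c₀ y
        · exact abs_real_inner_le_norm y h
    _ = (penaltyCoef c₀ y * ‖y‖) * ‖h‖ := by ring
    _ ≤ 1 * ‖h‖ := by gcongr; exact penaltyCoef_mul_norm_le c₀ y
    _ = ‖h‖ := one_mul _

lemma lipschitzWith_penalty : LipschitzWith 1 (penalty c₀ : E → ℝ) := by
  refine lipschitzWith_of_nnnorm_fderiv_le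
    (fun y => (hasFDerivAt_penalty c₀ y).differentiableAt) fun y => ?_
  rw [← NNReal.coe_le_coe, coe_nnnorm, (hasFDerivAt_penalty c₀ y).fderiv]
  refine ContinuousLinearMap.opNorm_le_bound _ (by simp) fun h => ?_
  simpa using abs_fderiv_penalty_apply_le c₀ y h

end Penalty

/-! ### A chain rule in time -/

section ChainRule

/-- The sums in the definition for `f` are at most `K` times those for `g`. It serves to compare a
Lipschitz function of `∫ g` with the scalar function `∫ ‖g‖`. -/
lemma _root_.AbsolutelyContinuousOnInterval.of_dist_le_mul {X Y : Type*} [PseudoMetricSpace X]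
    [PseudoMetricSpace Y] {f : ℝ → X} {g : ℝ → Y} {a b K : ℝ}
    (hg : AbsolutelyContinuousOnInterval g a b)
    (h : ∀ s ∈ uIcc a b, ∀ t ∈ uIcc a b, dist (f s) (f t) ≤ K * dist (g s) (g t)) :
    AbsolutelyContinuousOnInterval f a b := by
  unfold AbsolutelyContinuousOnInterval at hg ⊢
  refine squeeze_zero' (.of_forall fun I => Finset.sum_nonneg fun _ _ => dist_nonneg) ?_
    (by simpa using hg.const_mul K)
  rw [eventually_inf_principal]
  filter_upwards with I hI
  rw [Finset.mul_sum]
  exact Finset.sum_le_sum fun i hi => h _ (hI.1 i hi).1 _ (hI.1 i hi).2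

variable {E : Type*} [NormedAddCommGroup E] [NormedSpace ℝ E]
  {X : Type*} [MeasurableSpace X] {μ : Measure X}

/-- The variable endpoint is moved into the indicator of a measurable set of triples. Joint
measurability is what later permits exchanging "almost every `x`" and "almost every `t`". -/
lemma stronglyMeasurable_integral_zero_to {G : X × ℝ → E} (hG : StronglyMeasurable G) :
    StronglyMeasurable fun p : X × ℝ => ∫ s in Ioc 0 p.2, G (p.1, s) := by
  have hm : MeasurableSet {q : (X × ℝ) × ℝ | 0 < q.2 ∧ q.2 ≤ q.1.2} :=
    (measurableSet_lt measurable_const measurable_snd).inter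
      (measurableSet_le measurable_snd (measurable_snd.comp measurable_fst))
  have h1 : StronglyMeasurable fun q : (X × ℝ) × ℝ => G (q.1.1, q.2) :=
    hG.comp_measurable ((measurable_fst.comp measurable_fst).prodMk measurable_snd)
  have h2 := (h1.indicator hm).integral_prod_right' (ν := (volume : Measure ℝ))
  refine (funext fun p => ?_ : (fun p : X × ℝ => ∫ s in Ioc 0 p.2, G (p.1, s)) = _) ▸ h2
  rw [← integral_indicator measurableSet_Ioc]
  rfl

variable [CompleteSpace E]

/-- The chain rule for the composition of a Lipschitz function with an indefinite integral. -/
lemma sub_eq_integral_fderiv_comp_integral {K : NNReal} {Φ : E → ℝ} (hΦ : LipschitzWith K Φ)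
    (hd : Differentiable ℝ Φ) {g : ℝ → E} {T : ℝ} (hg : IntervalIntegrable g volume 0 T) (y : E) :
    Φ (y + ∫ s in (0 : ℝ)..T, g s) - Φ y
      = ∫ t in (0 : ℝ)..T, fderiv ℝ Φ (y + ∫ s in (0 : ℝ)..t, g s) (g t) := by
  have hac : AbsolutelyContinuousOnInterval (fun t => ∫ s in (0 : ℝ)..t, ‖g s‖) 0 T :=
    hg.norm.absolutelyContinuousOnInterval_intervalIntegral left_mem_uIcc
  have hsub : ∀ s ∈ uIcc 0 T, IntervalIntegrable g volume 0 s := fun s hs =>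
    hg.mono_set (uIcc_subset_uIcc_left hs)
  have hac' : AbsolutelyContinuousOnInterval (fun t => Φ (y + ∫ s in (0 : ℝ)..t, g s)) 0 T := by
    refine hac.of_dist_le_mul (K := K) fun s hs t ht => (hΦ.dist_le_mul _ _).trans ?_
    refine mul_le_mul_of_nonneg_left ?_ K.2
    rw [dist_add_left, dist_eq_norm, dist_eq_norm,
      intervalIntegral.integral_interval_sub_left (hsub s hs) (hsub t ht),
      intervalIntegral.integral_interval_sub_left (hsub s hs).norm (hsub t ht).norm]
    exact intervalIntegral.norm_integral_le_abs_integral_norm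
  have h1 := hac'.integral_deriv_eq_sub
  simp only [intervalIntegral.integral_same, add_zero] at h1
  rw [← h1]
  refine intervalIntegral.integral_congr_ae ?_
  filter_upwards [hg.ae_hasDerivAt_integral] with t ht htT
  have h2 := ht (uIoc_subset_uIcc htT) 0 (by simp)
  exact ((hd _).hasFDerivAt.comp_hasDerivAt t (h2.const_add y)).deriv

variable [SFinite μ]

/-- If `u(t) = u(0) + ∫₀ᵗ G` almost everywhere, for each `t`, then `Φ(u)` obeys the chain rule. -/
theorem ae_sub_eq_integral_fderiv {T : ℝ} (hT : 0 < T) {u : ℝ → X → E} {G : X × ℝ → E}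
    (hu : AEStronglyMeasurable (fun p : X × ℝ => u p.2 p.1)
      (μ.prod (volume.restrict (Ioo 0 T))))
    (hu0 : AEStronglyMeasurable (u 0) μ)
    (hG : Integrable G (μ.prod (volume.restrict (Ioo 0 T))))
    (h : ∀ t ∈ Ioc 0 T, ∀ᵐ x ∂μ, u t x = u 0 x + ∫ s in (0 : ℝ)..t, G (x, s))
    {K : NNReal} {Φ : E → ℝ} (hΦ : LipschitzWith K Φ) (hd : Differentiable ℝ Φ) :
    ∀ᵐ x ∂μ, Φ (u T x) - Φ (u 0 x)
      = ∫ t in (0 : ℝ)..T, fderiv ℝ Φ (u t x) (G (x, t)) := by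
  have hGm := hG.1
  have hGG : ∀ᵐ x ∂μ, ∀ᵐ t ∂(volume.restrict (Ioo 0 T)), G (x, t) = hGm.mk G (x, t) :=
    Measure.ae_ae_of_ae_prod hGm.ae_eq_mk
  have huu : ∀ᵐ x ∂μ, ∀ᵐ t ∂(volume.restrict (Ioo 0 T)), u t x = hu.mk _ (x, t) :=
    Measure.ae_ae_of_ae_prod hu.ae_eq_mk
  have huu' : ∀ᵐ t ∂(volume.restrict (Ioo 0 T)), ∀ᵐ x ∂μ, u t x = hu.mk _ (x, t) :=
    Measure.ae_ae_of_ae_prod (μ := volume.restrict (Ioo 0 T)) (ν := μ)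
      (p := fun q : ℝ × X => u q.1 q.2 = hu.mk _ (q.2, q.1))
      (Measure.measurePreserving_swap.quasiMeasurePreserving.ae hu.ae_eq_mk)
  have hint : ∀ᵐ x ∂μ, ∀ t ∈ Ioc 0 T,
      ∫ s in (0 : ℝ)..t, G (x, s) = ∫ s in Ioc 0 t, hGm.mk G (x, s) := by
    filter_upwards [hGG] with x hx t ht
    rw [intervalIntegral.integral_of_le ht.1.le, integral_Ioc_eq_integral_Ioo,
      integral_Ioc_eq_integral_Ioo]
    exact integral_congr_ae (ae_restrict_of_ae_restrict_of_subset
      (Ioo_subset_Ioo_right ht.2) hx)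
  have hq : StronglyMeasurable fun p : X × ℝ =>
      hu0.mk _ p.1 + ∫ s in Ioc 0 p.2, hGm.mk G (p.1, s) :=
    (hu0.stronglyMeasurable_mk.comp_measurable measurable_fst).add
      (stronglyMeasurable_integral_zero_to hGm.stronglyMeasurable_mk)
  have hqu : ∀ᵐ t ∂(volume.restrict (Ioo 0 T)), ∀ᵐ x ∂μ,
      hu.mk _ (x, t) = hu0.mk _ x + ∫ s in Ioc 0 t, hGm.mk G (x, s) := by
    filter_upwards [huu', ae_restrict_mem measurableSet_Ioo] with t ht htT
    filter_upwards [ht, h t ⟨htT.1, htT.2.le⟩, hint, hu0.ae_eq_mk] with x h1 h2 h3 h4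
    rw [← h1, h2, h3 t ⟨htT.1, htT.2.le⟩, h4]
  -- The exceptional set of `x` depends on `t`. Fubini makes it a null set of times for almost every
  -- `x`; the exchange needs a jointly measurable condition, hence the representatives `mk`.
  have hswap : ∀ᵐ x ∂μ, ∀ᵐ t ∂(volume.restrict (Ioo 0 T)),
      hu.mk _ (x, t) = hu0.mk _ x + ∫ s in Ioc 0 t, hGm.mk G (x, s) := by
    rw [Measure.ae_ae_comm]
    · exact hqu
    · exact hu.stronglyMeasurable_mk.measurableSet_eq_fun hq
  -- The endpoint `T` is one fixed time, so the hypothesis applies there directly; the other times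
  -- matter only almost everywhere, under the integral.
  filter_upwards [hswap, huu, hint, hu0.ae_eq_mk, hG.prod_right_ae, h T ⟨hT, le_rfl⟩]
    with x h1 h2 h3 h4 h5 h6
  have hgi : IntervalIntegrable (fun s => G (x, s)) volume 0 T := by
    rw [intervalIntegrable_iff_integrableOn_Ioo_of_le hT.le]
    exact h5
  rw [h6, sub_eq_integral_fderiv_comp_integral hΦ hd hgi, intervalIntegral.integral_of_le hT.le,
    intervalIntegral.integral_of_le hT.le, integral_Ioc_eq_integral_Ioo,
    integral_Ioc_eq_integral_Ioo]
  refine integral_congr_ae ?_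
  filter_upwards [h1, h2, ae_restrict_mem measurableSet_Ioo] with t e1 e2 htT
  rw [e2, e1, h3 t ⟨htT.1, htT.2.le⟩, h4]

end ChainRule

/-! ### Passage to the limit in integrals of products -/

section Limits

variable {X : Type*} [MeasurableSpace X] {μ : Measure X}

lemma integrable_mul_bdd_mul {f h g : X → ℝ} {C : ℝ} (hf : MemLp f 2 μ)
    (hm : AEStronglyMeasurable h μ) (hC : ∀ x, |h x| ≤ C) (hg : MemLp g 2 μ) :
    Integrable (fun x => f x * h x * g x) μ := by
  have h1 : Integrable (fun x => f x * g x) μ := hf.integrable_mul hg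
  refine (h1.bdd_mul hm (.of_forall hC)).congr (.of_forall fun x => ?_)
  simp only
  ring

/-- With `g` fixed, dominated convergence handles the bounded factor; the error from `g - gn n` is
controlled by Hölder. This matches the approximation below, where nonlinear coefficients converge
only almost everywhere but gradients converge in `L²`. -/
lemma tendsto_integral_mul_bdd_mul {f h g : X → ℝ} {hn gn : ℕ → X → ℝ} {C : ℝ}
    (hf : MemLp f 2 μ) (hm : ∀ n, AEStronglyMeasurable (hn n) μ) (hC : ∀ n x, |hn n x| ≤ C)
    (hlim : ∀ᵐ x ∂μ, Tendsto (fun n => hn n x) atTop (𝓝 (h x)))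
    (hg : MemLp g 2 μ) (hgn : ∀ n, MemLp (gn n) 2 μ)
    (hconv : Tendsto (fun n => eLpNorm (fun x => g x - gn n x) 2 μ) atTop (𝓝 0)) :
    Tendsto (fun n => ∫ x, f x * hn n x * gn n x ∂μ) atTop (𝓝 (∫ x, f x * h x * g x ∂μ)) := by
  have hd : ∀ n, MemLp (fun x => g x - gn n x) 2 μ := fun n => hg.sub (hgn n)
  have hsplit : ∀ n, ∫ x, f x * hn n x * gn n x ∂μ
      = (∫ x, f x * hn n x * g x ∂μ) - ∫ x, f x * hn n x * (g x - gn n x) ∂μ := fun n => by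
    rw [← integral_sub (integrable_mul_bdd_mul hf (hm n) (hC n) hg)
      (integrable_mul_bdd_mul hf (hm n) (hC n) (hd n))]
    congr with x
    ring
  simp only [hsplit]
  have hfg : Integrable (fun x => f x * g x) μ := hf.integrable_mul hg
  have h1 : Tendsto (fun n => ∫ x, f x * hn n x * g x ∂μ) atTop
      (𝓝 (∫ x, f x * h x * g x ∂μ)) := by
    refine tendsto_integral_of_dominated_convergence (fun x => C * |f x * g x|)
      (fun n => (integrable_mul_bdd_mul hf (hm n) (hC n) hg).1) (hfg.abs.const_mul C)
      (fun n => .of_forall fun x => ?_) ?_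
    · rw [Real.norm_eq_abs, show f x * hn n x * g x = hn n x * (f x * g x) by ring, abs_mul]
      gcongr
      exact hC n x
    · filter_upwards [hlim] with x hx
      exact (hx.const_mul (f x)).mul_const (g x)
  have h2 : Tendsto (fun n => ∫ x, f x * hn n x * (g x - gn n x) ∂μ) atTop (𝓝 0) := by
    rw [← integral_zero X ℝ (μ := μ)]
    refine tendsto_integral_of_L1' _ aestronglyMeasurable_const
      (.of_forall fun n => integrable_mul_bdd_mul hf (hm n) (hC n) (hd n)) ?_
    have hb : ∀ n, eLpNorm ((fun x => f x * hn n x * (g x - gn n x)) - fun _ => (0 : ℝ)) 1 μ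
        ≤ ENNReal.ofReal C * (eLpNorm f 2 μ * eLpNorm (fun x => g x - gn n x) 2 μ) := fun n => by
      have e1 : eLpNorm ((fun x => f x * hn n x * (g x - gn n x)) - fun _ => (0 : ℝ)) 1 μ
          ≤ ENNReal.ofReal C * eLpNorm (f • fun x => g x - gn n x) 1 μ := by
        refine eLpNorm_le_mul_eLpNorm_of_ae_le_mul (.of_forall fun x => ?_) 1
        simp only [Pi.sub_apply, sub_zero, Pi.smul_apply', smul_eq_mul, Real.norm_eq_abs]
        rw [show f x * hn n x * (g x - gn n x) = hn n x * (f x * (g x - gn n x)) by ring, abs_mul]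
        gcongr
        exact hC n x
      refine e1.trans ?_
      gcongr
      exact eLpNorm_smul_le_mul_eLpNorm (hd n).1 hf.1
    have hz : Tendsto (fun n => ENNReal.ofReal C *
        (eLpNorm f 2 μ * eLpNorm (fun x => g x - gn n x) 2 μ)) atTop (𝓝 0) := by
      have := ENNReal.Tendsto.const_mul (a := ENNReal.ofReal C)
        (ENNReal.Tendsto.const_mul (a := eLpNorm f 2 μ) hconv (Or.inr hf.2.ne))
        (Or.inr ENNReal.ofReal_ne_top)
      simpa using this
    exact tendsto_of_tendsto_of_tendsto_of_le_of_le tendsto_const_nhds hz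
      (fun n => zero_le) hb
  simpa using h1.sub h2

end Limits

/-! ### Vector valued functions with components in `H¹₀` -/

section Slices

variable {ι : Type*} [Fintype ι] {Ω : Set E3}

lemma IsTestFunction.memLp_pderiv {φ : E3 → ℝ} (hφ : IsTestFunction Ω φ) (k : Fin 3) :
    MemL2 Ω (pderiv k φ) := by
  have hc : Continuous (pderiv k φ) :=
    (hφ.smooth.continuous_fderiv (by simp)).clm_apply continuous_const
  have hs : HasCompactSupport (pderiv k φ) :=
    (hφ.compact.fderiv ℝ).comp_left (g := fun L : E3 →L[ℝ] ℝ => L (EuclideanSpace.single k 1)) rfl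
  exact (hc.memLp_of_hasCompactSupport hs).restrict Ω

/-- The components are approximated separately and assembled. A subsequence of the vector-valued
`L²` convergence gives pointwise convergence of all components at once, so that continuous functions
of `u` can pass to the limit. -/
lemma exists_test_approx {u : E3 → EuclideanSpace ℝ ι} {D : E3 → ι → Fin 3 → ℝ}
    (hu : ∀ p, IsH10With Ω (fun x => u x p) (fun x => D x p)) :
    ∃ φ : ℕ → E3 → EuclideanSpace ℝ ι,
      (∀ n, ContDiff ℝ ∞ (φ n)) ∧ (∀ n, HasCompactSupport (φ n)) ∧ (∀ n, tsupport (φ n) ⊆ Ω) ∧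
      (∀ᵐ x ∂(volume.restrict Ω), Tendsto (fun n => φ n x) atTop (𝓝 (u x))) ∧
      ∀ p k, Tendsto (fun n => eLpNorm (fun x => D x p k - pderiv k (fun y => φ n y p) x) 2
        (volume.restrict Ω)) atTop (𝓝 0) := by
  choose ψ hψ hconv using fun p => (hu p).approx
  let φ : ℕ → E3 → EuclideanSpace ℝ ι := fun n x => WithLp.toLp 2 fun p => ψ p n x
  have hsub : ∀ n, tsupport (φ n) ⊆ ⋃ p, tsupport (ψ p n) := fun n => by
    refine closure_minimal (fun x hx => ?_) (isClosed_iUnion_of_finite fun p => isClosed_tsupport _)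
    by_contra hcon
    simp only [mem_iUnion, not_exists] at hcon
    exact hx (PiLp.ext fun p => image_eq_zero_of_notMem_tsupport (f := ψ p n) (hcon p))
  have hvec : Tendsto (fun n => eLpNorm (φ n - u) 2 (volume.restrict Ω)) atTop (𝓝 0) := by
    have hle : ∀ n, eLpNorm (φ n - u) 2 (volume.restrict Ω) ≤
        ∑ p, eLpNorm (fun x => u x p - ψ p n x) 2 (volume.restrict Ω) := fun n => by
      have hm : ∀ p, AEStronglyMeasurable (fun x => ‖u x p - ψ p n x‖) (volume.restrict Ω) :=
        fun p => ((hu p).isH1.mem.1.sub (hψ p n).smooth.continuous.aestronglyMeasurable).norm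
      refine le_trans (eLpNorm_mono_real (g := fun x => ∑ p, ‖u x p - ψ p n x‖) fun x => ?_) ?_
      · rw [EuclideanSpace.norm_eq]
        refine (Real.sqrt_le_sqrt (Finset.sum_sq_le_sq_sum_of_nonneg
          fun p _ => norm_nonneg _)).trans ?_
        rw [Real.sqrt_sq (Finset.sum_nonneg fun p _ => norm_nonneg _)]
        exact Finset.sum_le_sum fun p _ => (norm_sub_rev _ _).le
      · have := eLpNorm_sum_le (s := Finset.univ) (p := 2)
          (f := fun p x => ‖u x p - ψ p n x‖) (fun p _ => hm p) (by norm_num)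
        simp only [eLpNorm_norm] at this
        refine le_trans (le_of_eq ?_) this
        congr 1
        ext x
        simp
    have hz : Tendsto (fun n => ∑ p, eLpNorm (fun x => u x p - ψ p n x) 2 (volume.restrict Ω))
        atTop (𝓝 0) := by
      have h0 := tendsto_finsetSum (Finset.univ : Finset ι) (x := atTop)
        (f := fun p n => eLpNorm (fun x => u x p - ψ p n x) 2 (volume.restrict Ω))
        (a := fun _ => 0) fun p _ => ?_
      · simpa using h0
      exact tendsto_of_tendsto_of_tendsto_of_le_of_le tendsto_const_nhds (hconv p)
        (fun n => zero_le) (fun n => le_self_add)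
    exact tendsto_of_tendsto_of_tendsto_of_le_of_le tendsto_const_nhds hz
      (fun n => zero_le) hle
  have hcd : ∀ n, ContDiff ℝ ∞ (φ n) := fun n => by
    rw [contDiff_euclidean]
    exact fun p => (hψ p n).smooth
  have hum : AEStronglyMeasurable u (volume.restrict Ω) := by
    have : AEMeasurable (fun x => (WithLp.ofLp (u x) : ι → ℝ)) (volume.restrict Ω) :=
      aemeasurable_pi_lambda _ fun p => (hu p).isH1.mem.1.aemeasurable
    exact ((PiLp.continuous_toLp 2 fun _ : ι => ℝ).measurable.comp_aemeasurable
      this).aestronglyMeasurable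
  obtain ⟨ns, hns, hae⟩ := (tendstoInMeasure_of_tendsto_eLpNorm (by norm_num)
    (fun n => (hcd n).continuous.aestronglyMeasurable) hum hvec).exists_seq_tendsto_ae
  refine ⟨fun n => φ (ns n), fun n => hcd _, fun n => ?_, fun n => ?_, hae, fun p k => ?_⟩
  · exact (isCompact_iUnion fun p => (hψ p (ns n)).compact).of_isClosed_subset
      (isClosed_tsupport _) (hsub _)
  · exact (hsub _).trans (iUnion_subset fun p => (hψ p (ns n)).subset)
  · refine tendsto_of_tendsto_of_tendsto_of_le_of_le tendsto_const_nhds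
      ((hconv p).comp hns.tendsto_atTop) (fun n => zero_le) (fun n => ?_)
    exact (Finset.single_le_sum (f := fun k => eLpNorm (fun x => D x p k - pderiv k (ψ p (ns n)) x)
      2 (volume.restrict Ω)) (fun _ _ => zero_le) (Finset.mem_univ k)).trans le_add_self

lemma isTestFunction_comp {φ : E3 → EuclideanSpace ℝ ι} (h1 : ContDiff ℝ ∞ φ)
    (h2 : HasCompactSupport φ) (h3 : tsupport φ ⊆ Ω) {F : EuclideanSpace ℝ ι → ℝ}
    (hF : ContDiff ℝ ∞ F) (hF0 : F 0 = 0) : IsTestFunction Ω (fun x => F (φ x)) where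
  smooth := hF.comp h1
  compact := h2.comp_left hF0
  subset := (tsupport_comp_subset hF0 φ).trans h3

lemma pderiv_apply {φ : E3 → EuclideanSpace ℝ ι} (h : Differentiable ℝ φ) (k : Fin 3) (x : E3)
    (p : ι) : pderiv k (fun y => φ y p) x = fderiv ℝ φ x (EuclideanSpace.single k 1) p := by
  have := ((EuclideanSpace.proj p : EuclideanSpace ℝ ι →L[ℝ] ℝ).hasFDerivAt (x := φ x)).comp x
    (h x).hasFDerivAt
  exact congrArg (fun L : E3 →L[ℝ] ℝ => L (EuclideanSpace.single k 1)) this.fderiv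

lemma inner_fderiv_eq_sum {φ : E3 → EuclideanSpace ℝ ι} (h : Differentiable ℝ φ) (k : Fin 3)
    (x : E3) (y : EuclideanSpace ℝ ι) :
    inner ℝ y (fderiv ℝ φ x (EuclideanSpace.single k 1))
      = ∑ p, y p * pderiv k (fun z => φ z p) x := by
  simp [PiLp.inner_apply, pderiv_apply h, mul_comm]

lemma pderiv_penalty_comp (c₀ : ℝ) {φ : E3 → EuclideanSpace ℝ ι} (h : Differentiable ℝ φ)
    (k : Fin 3) (x : E3) :
    pderiv k (fun y => penalty c₀ (φ y)) x
      = ∑ p, penaltyCoef c₀ (φ x) * φ x p * pderiv k (fun y => φ y p) x := by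
  have h1 := (hasFDerivAt_penalty c₀ (φ x)).comp x (h x).hasFDerivAt
  have h2 := congrArg (fun L : E3 →L[ℝ] ℝ => L (EuclideanSpace.single k 1)) h1.fderiv
  refine h2.trans ?_
  simp only [ContinuousLinearMap.comp_apply, smul_apply, innerSL_apply_apply, smul_eq_mul,
    inner_fderiv_eq_sum h, Finset.mul_sum, mul_assoc]

lemma pderiv_penaltyCoef_mul_comp (c₀ : ℝ) {φ : E3 → EuclideanSpace ℝ ι}
    (h : Differentiable ℝ φ) (k : Fin 3) (p : ι) (x : E3) :
    pderiv k (fun y => penaltyCoef c₀ (φ y) * φ y p) x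
      = penaltyCoef c₀ (φ x) * pderiv k (fun y => φ y p) x
        + ∑ r, penaltyCurv c₀ (φ x) * φ x p * φ x r * pderiv k (fun y => φ y r) x := by
  have h1 := (hasFDerivAt_penaltyCoef c₀ (φ x)).comp x (h x).hasFDerivAt
  have h2 := ((EuclideanSpace.proj p : EuclideanSpace ℝ ι →L[ℝ] ℝ).hasFDerivAt
    (x := φ x)).comp x (h x).hasFDerivAt
  have h3 := congrArg (fun L : E3 →L[ℝ] ℝ => L (EuclideanSpace.single k 1)) (h1.mul h2).fderiv
  refine h3.trans ?_
  simp only [ContinuousLinearMap.comp_apply, smul_apply, add_apply, innerSL_apply_apply,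
    smul_eq_mul, inner_fderiv_eq_sum h, Function.comp, EuclideanSpace.coe_proj,
    pderiv_apply h]
  congr 1
  rw [Finset.mul_sum, Finset.mul_sum]
  exact Finset.sum_congr rfl fun r _ => by ring

lemma abs_apply_le_norm (y : EuclideanSpace ℝ ι) (p : ι) : |y p| ≤ ‖y‖ :=
  PiLp.norm_apply_le y p

lemma abs_penaltyCoef_mul_apply_le (c₀ : ℝ) (y : EuclideanSpace ℝ ι) (p : ι) :
    |penaltyCoef c₀ y * y p| ≤ 1 := by
  rw [abs_mul, abs_of_nonneg (penaltyCoef_nonneg c₀ y)]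
  exact (mul_le_mul_of_nonneg_left (abs_apply_le_norm y p) (penaltyCoef_nonneg c₀ y)).trans
    (penaltyCoef_mul_norm_le c₀ y)

lemma continuous_penaltyCoef_mul_apply (c₀ : ℝ) (p : ι) :
    Continuous fun y : EuclideanSpace ℝ ι => penaltyCoef c₀ y * y p :=
  (contDiff_penaltyCoef c₀).continuous.mul (by fun_prop)

lemma contDiff_penaltyCoef_mul_apply (c₀ : ℝ) (p : ι) :
    ContDiff ℝ ∞ fun y : EuclideanSpace ℝ ι => penaltyCoef c₀ y * y p :=
  (contDiff_penaltyCoef c₀).mul (EuclideanSpace.proj p : EuclideanSpace ℝ ι →L[ℝ] ℝ).contDiff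

lemma isTestFunction_apply {φ : E3 → EuclideanSpace ℝ ι} (h1 : ContDiff ℝ ∞ φ)
    (h2 : HasCompactSupport φ) (h3 : tsupport φ ⊆ Ω) (p : ι) :
    IsTestFunction Ω (fun x => φ x p) :=
  isTestFunction_comp h1 h2 h3 (F := fun y => y p)
    (EuclideanSpace.proj p : EuclideanSpace ℝ ι →L[ℝ] ℝ).contDiff rfl

/-- Transport by a solenoidal field does not change the integral of the penalty. -/
theorem integral_transport_penalty_eq_zero {c₀ : ℝ} (hc₀ : 0 ≤ c₀) {w : E3 → E3}
    (hw : IsL2Sigma Ω w) {u : E3 → EuclideanSpace ℝ ι} {D : E3 → ι → Fin 3 → ℝ}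
    (hu : ∀ p, IsH10With Ω (fun x => u x p) (fun x => D x p)) :
    ∫ x in Ω, ∑ k, ∑ p, w x k * (penaltyCoef c₀ (u x) * u x p) * D x p k = 0 := by
  obtain ⟨φ, h1, h2, h3, hae, hgrad⟩ := exists_test_approx hu
  have hd : ∀ n, Differentiable ℝ (φ n) := fun n => (h1 n).differentiable (by simp)
  have hum : AEStronglyMeasurable u (volume.restrict Ω) :=
    aestronglyMeasurable_of_tendsto_ae atTop
      (fun n => (h1 n).continuous.aestronglyMeasurable) hae
  have hWm : ∀ (n : ℕ) (p : ι), AEStronglyMeasurable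
      (fun x => penaltyCoef c₀ (φ n x) * φ n x p) (volume.restrict Ω) := fun n p =>
    ((continuous_penaltyCoef_mul_apply c₀ p).comp (h1 n).continuous).aestronglyMeasurable
  have hφ2 : ∀ (n : ℕ) (p : ι) (k : Fin 3), MemL2 Ω (pderiv k fun y => φ n y p) := fun n p k =>
    (isTestFunction_apply (h1 n) (h2 n) (h3 n) p).memLp_pderiv k
  have hzero : ∀ n, ∑ k, ∑ p, ∫ x in Ω, w x k * (penaltyCoef c₀ (φ n x) * φ n x p)
      * pderiv k (fun y => φ n y p) x = 0 := fun n => by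
    -- The origin lies in the ball where the penalty vanishes, so the composition keeps compact
    -- support in `Ω` and may test the divergence condition.
    have htest : IsTestFunction Ω fun x => penalty c₀ (φ n x) :=
      isTestFunction_comp (h1 n) (h2 n) (h3 n) (contDiff_penalty c₀)
        ((penalty_eq_zero_iff hc₀ 0).2 (by simpa using hc₀))
    rw [← hw.div_eq_zero _ htest, integral_finsetSum]
    · refine Finset.sum_congr rfl fun k _ => ?_
      rw [← integral_finsetSum]
      · congr with x
        rw [pderiv_penalty_comp c₀ (hd n), Finset.mul_sum]
        exact Finset.sum_congr rfl fun p _ => by ring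
      · exact fun p _ => integrable_mul_bdd_mul (hw.mem k) (hWm n p)
          (fun x => abs_penaltyCoef_mul_apply_le c₀ _ p) (hφ2 n p k)
    · exact fun k _ => (hw.mem k).integrable_mul (htest.memLp_pderiv k)
  have hlim : Tendsto (fun n => ∑ k, ∑ p, ∫ x in Ω, w x k *
      (penaltyCoef c₀ (φ n x) * φ n x p) * pderiv k (fun y => φ n y p) x) atTop
      (𝓝 (∑ k, ∑ p, ∫ x in Ω, w x k * (penaltyCoef c₀ (u x) * u x p) * D x p k)) := by
    refine tendsto_finsetSum _ fun k _ => tendsto_finsetSum _ fun p _ => ?_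
    refine tendsto_integral_mul_bdd_mul (hw.mem k) (fun n => hWm n p)
      (fun n x => abs_penaltyCoef_mul_apply_le c₀ _ p) ?_ ((hu p).isH1.mem_grad k)
      (fun n => hφ2 n p k) (hgrad p k)
    filter_upwards [hae] with x hx
    exact ((continuous_penaltyCoef_mul_apply c₀ p).tendsto (u x)).comp hx
  simp only [hzero] at hlim
  have hWu : ∀ p : ι, AEStronglyMeasurable
      (fun x => penaltyCoef c₀ (u x) * u x p) (volume.restrict Ω) := fun p =>
    (continuous_penaltyCoef_mul_apply c₀ p).comp_aestronglyMeasurable hum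
  have hi : ∀ (k : Fin 3) (p : ι), Integrable
      (fun x => w x k * (penaltyCoef c₀ (u x) * u x p) * D x p k) (volume.restrict Ω) :=
    fun k p => integrable_mul_bdd_mul (hw.mem k) (hWu p)
      (fun x => abs_penaltyCoef_mul_apply_le c₀ _ p) ((hu p).isH1.mem_grad k)
  rw [integral_finsetSum _ fun k _ => integrable_finsetSum _ fun p _ => hi k p]
  refine Eq.trans (Finset.sum_congr rfl fun k _ => ?_) (tendsto_nhds_unique hlim tendsto_const_nhds)
  exact integral_finsetSum _ fun p _ => hi k p

/-- Diffusion does not increase the integral of the penalty. -/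
theorem integral_laplacian_penalty_nonpos [IsFiniteMeasure (volume.restrict Ω)]
    (c₀ : ℝ) {u : E3 → EuclideanSpace ℝ ι}
    {D : E3 → ι → Fin 3 → ℝ} {D2 : E3 → ι → Fin 3 → Fin 3 → ℝ}
    (hu : ∀ p, IsH10With Ω (fun x => u x p) (fun x => D x p))
    (hD : ∀ p k, IsH1With Ω (fun x => D x p k) (fun x => D2 x p k)) :
    ∫ x in Ω, ∑ p, ∑ k, D2 x p k k * (penaltyCoef c₀ (u x) * u x p) ≤ 0 := by
  obtain ⟨φ, h1, h2, h3, hae, hgrad⟩ := exists_test_approx hu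
  obtain ⟨C, -, hC⟩ := exists_abs_penaltyCurv_mul_le (E := EuclideanSpace ℝ ι) c₀
  have hd : ∀ n, Differentiable ℝ (φ n) := fun n => (h1 n).differentiable (by simp)
  have hum : AEStronglyMeasurable u (volume.restrict Ω) :=
    aestronglyMeasurable_of_tendsto_ae atTop
      (fun n => (h1 n).continuous.aestronglyMeasurable) hae
  have hcoef : Continuous (penaltyCoef c₀ : EuclideanSpace ℝ ι → ℝ) :=
    (contDiff_penaltyCoef c₀).continuous
  have hcoefb : ∀ y : EuclideanSpace ℝ ι, |penaltyCoef c₀ y| ≤ 1 := fun y => by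
    rw [abs_of_nonneg (penaltyCoef_nonneg c₀ y)]
    exact penaltyCoef_le_one c₀ y
  have hcurv : ∀ p r : ι, Continuous
      fun y : EuclideanSpace ℝ ι => penaltyCurv c₀ y * y p * y r := fun p r =>
    ((continuous_penaltyCurv c₀).mul (by fun_prop)).mul (by fun_prop)
  have hcurvb : ∀ (p r : ι) (y : EuclideanSpace ℝ ι), |penaltyCurv c₀ y * y p * y r| ≤ C := by
    intro p r y
    refine le_trans ?_ (hC y)
    rw [mul_assoc, abs_mul, abs_mul, pow_two]
    gcongr <;> exact abs_apply_le_norm y _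
  have hφ2 : ∀ (n : ℕ) (p : ι) (k : Fin 3), MemL2 Ω (pderiv k fun y => φ n y p) := fun n p k =>
    (isTestFunction_apply (h1 n) (h2 n) (h3 n) p).memLp_pderiv k
  have hDm : ∀ p k, MemL2 Ω fun x => D x p k := fun p k => (hu p).isH1.mem_grad k
  -- Only the coefficient is approximated: `m(φₙ) φₙ` is a test function, so the weak derivative of
  -- `D` moves onto it without a boundary term. The factor `1` on the left fits the three-factor
  -- limit lemma.
  have hparts : ∀ n, ∑ p, ∑ k, ∫ x in Ω, D2 x p k k * (penaltyCoef c₀ (φ n x) * φ n x p) * 1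
      = -∑ p, ∑ k, ((∫ x in Ω, D x p k * penaltyCoef c₀ (φ n x) * pderiv k (fun y => φ n y p) x)
        + ∑ r, ∫ x in Ω, D x p k * (penaltyCurv c₀ (φ n x) * φ n x p * φ n x r)
          * pderiv k (fun y => φ n y r) x) := fun n => by
    rw [← Finset.sum_neg_distrib]
    refine Finset.sum_congr rfl fun p _ => ?_
    rw [← Finset.sum_neg_distrib]
    refine Finset.sum_congr rfl fun k _ => ?_
    have htest := isTestFunction_comp (Ω := Ω) (h1 n) (h2 n) (h3 n)
      (contDiff_penaltyCoef_mul_apply c₀ p) (by simp)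
    have hw := ((hD p k).weak k).integral_eq _ htest
    simp only [mul_one]
    rw [eq_neg_iff_add_eq_zero, add_comm, ← eq_neg_iff_add_eq_zero, ← hw, ← integral_finsetSum,
      ← integral_add]
    · congr with x
      rw [pderiv_penaltyCoef_mul_comp c₀ (hd n), mul_add, Finset.mul_sum]
      congr 1
      · ring
      · exact Finset.sum_congr rfl fun r _ => by ring
    · exact integrable_mul_bdd_mul (hDm p k) (hcoef.comp (h1 n).continuous).aestronglyMeasurable
        (fun x => hcoefb _) (hφ2 n p k)
    · exact integrable_finsetSum _ fun r _ => integrable_mul_bdd_mul (hDm p k)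
        ((hcurv p r).comp (h1 n).continuous).aestronglyMeasurable
        (fun x => hcurvb p r _) (hφ2 n r k)
    · exact fun r _ => integrable_mul_bdd_mul (hDm p k)
        ((hcurv p r).comp (h1 n).continuous).aestronglyMeasurable
        (fun x => hcurvb p r _) (hφ2 n r k)
  have hL : Tendsto (fun n => ∑ p, ∑ k, ∫ x in Ω, D2 x p k k *
      (penaltyCoef c₀ (φ n x) * φ n x p) * 1) atTop
      (𝓝 (∑ p, ∑ k, ∫ x in Ω, D2 x p k k * (penaltyCoef c₀ (u x) * u x p) * 1)) := by
    refine tendsto_finsetSum _ fun p _ => tendsto_finsetSum _ fun k _ => ?_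
    refine tendsto_integral_mul_bdd_mul ((hD p k).mem_grad k) (fun n =>
        ((continuous_penaltyCoef_mul_apply c₀ p).comp (h1 n).continuous).aestronglyMeasurable)
      (fun n x => abs_penaltyCoef_mul_apply_le c₀ _ p) ?_ (memLp_const 1)
      (fun n => memLp_const 1) (by simp)
    filter_upwards [hae] with x hx
    exact ((continuous_penaltyCoef_mul_apply c₀ p).tendsto (u x)).comp hx
  have hR : Tendsto (fun n => -∑ p, ∑ k,
        ((∫ x in Ω, D x p k * penaltyCoef c₀ (φ n x) * pderiv k (fun y => φ n y p) x)
        + ∑ r, ∫ x in Ω, D x p k * (penaltyCurv c₀ (φ n x) * φ n x p * φ n x r)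
          * pderiv k (fun y => φ n y r) x)) atTop
      (𝓝 (-∑ p, ∑ k, ((∫ x in Ω, D x p k * penaltyCoef c₀ (u x) * D x p k)
        + ∑ r, ∫ x in Ω, D x p k * (penaltyCurv c₀ (u x) * u x p * u x r) * D x r k))) := by
    refine (tendsto_finsetSum _ fun p _ => tendsto_finsetSum _ fun k _ =>
      (Tendsto.add ?_ (tendsto_finsetSum _ fun r _ => ?_))).neg
    · refine tendsto_integral_mul_bdd_mul (hDm p k) (fun n =>
        (hcoef.comp (h1 n).continuous).aestronglyMeasurable)
        (fun n x => hcoefb _) ?_ (hDm p k) (fun n => hφ2 n p k) (hgrad p k)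
      filter_upwards [hae] with x hx
      exact (hcoef.tendsto (u x)).comp hx
    · refine tendsto_integral_mul_bdd_mul (hDm p k) (fun n =>
        ((hcurv p r).comp (h1 n).continuous).aestronglyMeasurable)
        (fun n x => hcurvb p r _) ?_ (hDm r k) (fun n => hφ2 n r k) (hgrad r k)
      filter_upwards [hae] with x hx
      exact ((hcurv p r).tendsto (u x)).comp hx
  have hi1 : ∀ (p : ι) (k : Fin 3), Integrable
      (fun x => D2 x p k k * (penaltyCoef c₀ (u x) * u x p)) (volume.restrict Ω) := fun p k => by
    simpa using integrable_mul_bdd_mul ((hD p k).mem_grad k)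
      ((continuous_penaltyCoef_mul_apply c₀ p).comp_aestronglyMeasurable hum)
      (fun x => abs_penaltyCoef_mul_apply_le c₀ _ p) (memLp_const (1 : ℝ))
  have hi2 : ∀ (p : ι) (k : Fin 3), Integrable
      (fun x => D x p k * penaltyCoef c₀ (u x) * D x p k) (volume.restrict Ω) := fun p k =>
    integrable_mul_bdd_mul (hDm p k) (hcoef.comp_aestronglyMeasurable hum)
      (fun x => hcoefb _) (hDm p k)
  have hi3 : ∀ (p : ι) (k : Fin 3) (r : ι), Integrable
      (fun x => D x p k * (penaltyCurv c₀ (u x) * u x p * u x r) * D x r k)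
      (volume.restrict Ω) := fun p k r =>
    integrable_mul_bdd_mul (hDm p k) ((hcurv p r).comp_aestronglyMeasurable hum)
      (fun x => hcurvb p r _) (hDm r k)
  have heq := tendsto_nhds_unique (hL.congr hparts) hR
  have hsum : ∫ x in Ω, ∑ p, ∑ k, D2 x p k k * (penaltyCoef c₀ (u x) * u x p)
      = ∑ p, ∑ k, ∫ x in Ω, D2 x p k k * (penaltyCoef c₀ (u x) * u x p) * 1 := by
    simp only [mul_one]
    rw [integral_finsetSum _ fun p _ => integrable_finsetSum _ fun k _ => hi1 p k]
    exact Finset.sum_congr rfl fun p _ => integral_finsetSum _ fun k _ => hi1 p k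
  rw [hsum, heq, neg_nonpos]
  have hsum2 : ∑ p, ∑ k, ((∫ x in Ω, D x p k * penaltyCoef c₀ (u x) * D x p k)
        + ∑ r, ∫ x in Ω, D x p k * (penaltyCurv c₀ (u x) * u x p * u x r) * D x r k)
      = ∫ x in Ω, ∑ p, ∑ k, (D x p k * penaltyCoef c₀ (u x) * D x p k
        + ∑ r, D x p k * (penaltyCurv c₀ (u x) * u x p * u x r) * D x r k) := by
    have hi4 : ∀ (p : ι) (k : Fin 3), Integrable
        (fun x => ∑ r, D x p k * (penaltyCurv c₀ (u x) * u x p * u x r) * D x r k)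
        (volume.restrict Ω) := fun p k => integrable_finsetSum _ fun r _ => hi3 p k r
    have hi5 : ∀ (p : ι) (k : Fin 3), Integrable
        (fun x => D x p k * penaltyCoef c₀ (u x) * D x p k
          + ∑ r, D x p k * (penaltyCurv c₀ (u x) * u x p * u x r) * D x r k)
        (volume.restrict Ω) := fun p k => (hi2 p k).add (hi4 p k)
    rw [integral_finsetSum _ fun p _ => integrable_finsetSum _ fun k _ => hi5 p k]
    refine Finset.sum_congr rfl fun p _ => ?_
    rw [integral_finsetSum _ fun k _ => hi5 p k]
    refine Finset.sum_congr rfl fun k _ => ?_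
    rw [integral_add (hi2 p k) (hi4 p k), integral_finsetSum _ fun r _ => hi3 p k r]
  rw [hsum2]
  refine integral_nonneg fun x => ?_
  rw [Pi.zero_apply, Finset.sum_comm]
  refine Finset.sum_nonneg fun k _ => ?_
  -- Convexity is applied to each directional derivative `∂ₖ u` separately.
  have hpos := penalty_hessian_nonneg c₀ (u x) (WithLp.toLp 2 fun p => D x p k)
  rw [EuclideanSpace.norm_sq_eq] at hpos
  simp only [PiLp.inner_apply, RCLike.inner_apply, conj_trivial, Real.norm_eq_abs, sq_abs] at hpos
  refine hpos.trans_eq ?_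
  rw [Finset.sum_add_distrib, Finset.mul_sum, pow_two (∑ p, _), Finset.sum_mul_sum,
    Finset.mul_sum]
  congr 1
  · exact Finset.sum_congr rfl fun p _ => by ring
  · refine Finset.sum_congr rfl fun p _ => ?_
    rw [Finset.mul_sum]
    exact Finset.sum_congr rfl fun r _ => by ring

end Slices

/-! ### The Sobolev embedding of `H¹₀` into `L³` -/

section Sobolev

variable {Ω : Set E3}

lemma norm_fderiv_le_sum_pderiv (φ : E3 → ℝ) (x : E3) :
    ‖fderiv ℝ φ x‖ ≤ ∑ k, ‖pderiv k φ x‖ := by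
  refine ContinuousLinearMap.opNorm_le_bound _ (Finset.sum_nonneg fun _ _ => norm_nonneg _)
    fun y => ?_
  have hy : y = ∑ k, y k • EuclideanSpace.single k (1 : ℝ) := by
    ext i
    simp [Pi.single_apply]
  conv_lhs => rw [hy]
  rw [map_sum, Finset.sum_mul]
  refine (norm_sum_le _ _).trans (Finset.sum_le_sum fun k _ => ?_)
  rw [map_smul, norm_smul, mul_comm]
  exact mul_le_mul_of_nonneg_left (PiLp.norm_apply_le y k) (norm_nonneg _)

lemma eLpNorm_fderiv_le_sum_pderiv {φ : E3 → ℝ} (hφ : IsTestFunction Ω φ) :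
    eLpNorm (fderiv ℝ φ) 2 volume ≤ ∑ k, eLpNorm (pderiv k φ) 2 (volume.restrict Ω) := by
  have hsupp : (Function.support fun x => ‖fderiv ℝ φ x‖) ⊆ Ω := fun x hx =>
    hφ.subset (support_fderiv_subset ℝ fun h0 => hx (by simp [h0]))
  rw [← eLpNorm_norm, ← eLpNorm_restrict_eq_of_support_subset hsupp, eLpNorm_norm]
  refine (eLpNorm_mono_real (norm_fderiv_le_sum_pderiv φ)).trans ?_
  have h2 := eLpNorm_sum_le (s := Finset.univ) (p := 2) (μ := volume.restrict Ω)
    (f := fun k x => ‖pderiv k φ x‖) (fun k _ => (hφ.memLp_pderiv k).1.norm) (by norm_num)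
  simp only [eLpNorm_norm] at h2
  refine le_trans (le_of_eq ?_) h2
  congr 1

lemma exists_eLpNorm_test_le (hΩ : Bornology.IsBounded Ω) :
    ∃ C : NNReal, ∀ φ : E3 → ℝ, IsTestFunction Ω φ →
      eLpNorm φ 3 (volume.restrict Ω) ≤
        C * ∑ k, eLpNorm (pderiv k φ) 2 (volume.restrict Ω) := by
  refine ⟨eLpNormLESNormFDerivOfLeConst ℝ (volume : Measure E3) Ω 2 3, fun φ hφ => ?_⟩
  -- Gagliardo–Nirenberg–Sobolev in dimension three: `1/2 - 1/3 ≤ 1/3`, so the exponent `3` is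
  -- subcritical, and `Ω` is bounded.
  have h1 : eLpNorm φ ((3 : NNReal) : ℝ≥0∞) volume ≤ _ :=
    eLpNorm_le_eLpNorm_fderiv_of_le (volume : Measure E3) (p := 2) (q := 3)
    (hφ.smooth.of_le (by exact_mod_cast le_top)) ((subset_tsupport φ).trans hφ.subset)
    (by norm_num) (by simp; norm_num) (by simp; norm_num) hΩ
  refine (eLpNorm_mono_measure φ Measure.restrict_le_self).trans (le_trans h1 ?_)
  gcongr
  exact eLpNorm_fderiv_le_sum_pderiv hφ

lemma exists_eLpNorm_three_le_h1Norm (hΩ : Bornology.IsBounded Ω) :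
    ∃ C : NNReal, ∀ (u : E3 → ℝ) (Du : E3 → Fin 3 → ℝ), IsH10With Ω u Du →
      eLpNorm u 3 (volume.restrict Ω) ≤ C * h1Norm Ω u Du := by
  obtain ⟨C, hC⟩ := exists_eLpNorm_test_le hΩ
  refine ⟨C, fun u Du hu => ?_⟩
  obtain ⟨φ, h1, h2, h3, hae, hgrad⟩ := exists_test_approx (ι := Unit)
    (u := fun x => WithLp.toLp 2 fun _ => u x) (D := fun x _ => Du x) fun _ => hu
  have htest : ∀ n, IsTestFunction Ω fun x => φ n x () := fun n =>
    isTestFunction_apply (h1 n) (h2 n) (h3 n) ()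
  have hae' : ∀ᵐ x ∂(volume.restrict Ω), Tendsto (fun n => φ n x ()) atTop (𝓝 (u x)) := by
    filter_upwards [hae] with x hx
    exact ((PiLp.continuous_apply 2 (fun _ : Unit => ℝ) ()).tendsto _).comp hx
  -- Fatou's lemma carries the estimate from the test functions to `u`; no convergence in `L³` is
  -- needed.
  have hlim := Lp.eLpNorm_lim_le_liminf_eLpNorm (p := 3)
    (fun n => (htest n).smooth.continuous.aestronglyMeasurable) u hae'
  have hbd : ∀ n, eLpNorm (fun x => φ n x ()) 3 (volume.restrict Ω) ≤
      C * ∑ k, (eLpNorm (fun x => Du x k) 2 (volume.restrict Ω) +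
        eLpNorm (fun x => Du x k - pderiv k (fun y => φ n y ()) x) 2 (volume.restrict Ω)) := by
    intro n
    refine (hC _ (htest n)).trans ?_
    gcongr with k
    have e : pderiv k (fun y => φ n y ()) = (fun x => Du x k)
        - fun x => Du x k - pderiv k (fun y => φ n y ()) x := by
      ext x
      simp
    conv_lhs => rw [e]
    exact eLpNorm_sub_le (hu.isH1.mem_grad k).1
      ((hu.isH1.mem_grad k).1.sub ((htest n).memLp_pderiv k).1) (by norm_num)
  have hT : Tendsto (fun n => (C : ℝ≥0∞) * ∑ k, (eLpNorm (fun x => Du x k) 2 (volume.restrict Ω) +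
        eLpNorm (fun x => Du x k - pderiv k (fun y => φ n y ()) x) 2 (volume.restrict Ω))) atTop
      (𝓝 (C * ∑ k, (eLpNorm (fun x => Du x k) 2 (volume.restrict Ω) + 0))) :=
    ENNReal.Tendsto.const_mul (tendsto_finsetSum _ fun k _ =>
      tendsto_const_nhds.add (hgrad () k)) (Or.inr ENNReal.coe_ne_top)
  refine hlim.trans ((liminf_le_liminf (.of_forall hbd)).trans ?_)
  rw [hT.liminf_eq]
  simp only [add_zero]
  gcongr
  exact le_add_self

lemma memLp_prod_of_eLpNorm_slice_le {X : Type*} [MeasurableSpace X] {μ : Measure X} [SFinite μ]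
    {ν : Measure ℝ} [IsFiniteMeasure ν] {u : ℝ → X → ℝ} {M : ℝ≥0∞} (hM : M ≠ ⊤)
    (hm : AEStronglyMeasurable (fun p : X × ℝ => u p.2 p.1) (μ.prod ν))
    (hb : ∀ᵐ t ∂ν, eLpNorm (u t) 3 μ ≤ M) :
    MemLp (fun p : X × ℝ => u p.2 p.1) 3 (μ.prod ν) := by
  refine ⟨hm, ?_⟩
  rw [eLpNorm_lt_top_iff_lintegral_rpow_enorm_lt_top (by norm_num) (by norm_num),
    lintegral_prod_symm _ (hm.enorm.pow_const _)]
  refine lt_of_le_of_lt (lintegral_mono_ae (g := fun _ => M ^ (3 : ℝ)) ?_) ?_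
  · filter_upwards [hb] with t ht
    rw [eLpNorm_eq_lintegral_rpow_enorm_toReal (by norm_num) (by norm_num)] at ht
    have := ENNReal.rpow_le_rpow ht (by norm_num : (0 : ℝ) ≤ 3)
    rw [← ENNReal.rpow_mul] at this
    simpa using this
  · rw [lintegral_const]
    exact ENNReal.mul_lt_top (ENNReal.rpow_lt_top_of_nonneg (by norm_num) hM) (measure_lt_top _ _)

end Sobolev

/-! ### Algebra of Q-tensors -/

section Algebra

/-- A `3 × 3` matrix as a vector of the Euclidean space `ℝ⁹`. -/
def vec (A : Mat3) : EuclideanSpace ℝ (Fin 3 × Fin 3) := WithLp.toLp 2 fun p => A p.1 p.2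

@[simp] lemma vec_apply (A : Mat3) (p : Fin 3 × Fin 3) : vec A p = A p.1 p.2 := rfl

lemma inner_vec (A B : Mat3) : inner ℝ (vec A) (vec B) = dot A B := by
  simp [PiLp.inner_apply, dot, Fintype.sum_prod_type, mul_comm]

lemma norm_vec_sq (A : Mat3) : ‖vec A‖ ^ 2 = dot A A := by
  rw [← inner_vec, real_inner_self_eq_norm_sq]

lemma norm_vec (A : Mat3) : ‖vec A‖ = frobNorm A := by
  rw [frobNorm, ← norm_vec_sq, Real.sqrt_sq (norm_nonneg _)]

lemma abs_entry_le (A : Mat3) (i j : Fin 3) : |A i j| ≤ ‖vec A‖ :=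
  abs_apply_le_norm (vec A) (i, j)

/-- Cauchy–Schwarz on each row–column product; the sum over rows and columns then factorises. -/
lemma norm_vec_mul_self_le (A : Mat3) : ‖vec (A * A)‖ ≤ ‖vec A‖ ^ 2 := by
  refine le_of_sq_le_sq ?_ (by positivity)
  rw [norm_vec_sq, norm_vec_sq, pow_two (dot A A)]
  calc dot (A * A) (A * A) ≤ ∑ i, ∑ j, (∑ k, A i k ^ 2) * ∑ k, A k j ^ 2 := by
        refine Finset.sum_le_sum fun i _ => Finset.sum_le_sum fun j _ => ?_
        rw [← pow_two, Matrix.mul_apply]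
        exact Finset.sum_mul_sq_le_sq_mul_sq _ _ _
    _ = dot A A * dot A A := by
        simp only [dot, ← pow_two, ← Finset.mul_sum, ← Finset.sum_mul]
        rw [Finset.sum_comm (f := fun j k => A k j ^ 2), pow_two (∑ i, _)]

/-- The term `(b/3)|A|² I` disappears because `A : I = tr A = 0`. -/
lemma dot_bulkGrad {A : Mat3} (hA : A ∈ QTensor) (a b c : ℝ) :
    dot A (bulkGrad a b c A) = a * dot A A - b * dot A (A * A) + c * dot A A ^ 2 := by
  have htr : A.trace = 0 := hA.2
  rw [Matrix.trace_fin_three] at htr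
  simp only [bulkGrad, dot, Matrix.add_apply, Matrix.sub_apply, Matrix.smul_apply, smul_eq_mul,
    Fin.sum_univ_three, Matrix.one_apply_eq, Matrix.one_apply_ne (by decide : (0 : Fin 3) ≠ 1),
    Matrix.one_apply_ne (by decide : (0 : Fin 3) ≠ 2),
    Matrix.one_apply_ne (by decide : (1 : Fin 3) ≠ 2),
    Matrix.one_apply_ne (by decide : (1 : Fin 3) ≠ 0),
    Matrix.one_apply_ne (by decide : (2 : Fin 3) ≠ 0),
    Matrix.one_apply_ne (by decide : (2 : Fin 3) ≠ 1)]
  linear_combination (b / 3 * (A 0 0 * A 0 0 + A 0 1 * A 0 1 + A 0 2 * A 0 2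
    + (A 1 0 * A 1 0 + A 1 1 * A 1 1 + A 1 2 * A 1 2)
    + (A 2 0 * A 2 0 + A 2 1 * A 2 1 + A 2 2 * A 2 2))) * htr

/-- The bulk force points inwards outside the ball of radius `c₀`. -/
lemma dot_bulkGrad_nonneg {a b c c₀ : ℝ} (hb : 0 < b) (hc : 0 < c) (hc₀ : 0 < c₀)
    (hμ : b ^ 2 / c ^ 2 - 2 * a / c ≤ c₀ ^ 2) {A : Mat3} (hA : A ∈ QTensor) (h : c₀ ≤ ‖vec A‖) :
    0 ≤ dot A (bulkGrad a b c A) := by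
  have h1 : dot A (A * A) ≤ ‖vec A‖ ^ 3 := by
    rw [← inner_vec]
    calc _ ≤ ‖vec A‖ * ‖vec (A * A)‖ := real_inner_le_norm _ _
      _ ≤ ‖vec A‖ * ‖vec A‖ ^ 2 := by gcongr; exact norm_vec_mul_self_le A
      _ = _ := by ring
  rw [dot_bulkGrad hA, ← norm_vec_sq]
  set s := ‖vec A‖
  have hs : 0 < s := hc₀.trans_le h
  have h2 : b ^ 2 - 2 * a * c ≤ c ^ 2 * s ^ 2 := by
    have e : b ^ 2 - 2 * a * c = (b ^ 2 / c ^ 2 - 2 * a / c) * c ^ 2 := by field_simp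
    rw [e, mul_comm (c ^ 2)]
    gcongr
    exact hμ.trans (by gcongr)
  have h3 : 0 ≤ a - b * s + c * s ^ 2 := by
    -- The identity is `2c(a - bs + cs²) = (cs - b)² + (c²s² - (b² - 2ac))`, which explains the
    -- threshold `b²/c² - 2a/c`.
    have : 0 ≤ 2 * c * (a - b * s + c * s ^ 2) := by nlinarith [sq_nonneg (c * s - b)]
    exact nonneg_of_mul_nonneg_right this (by positivity)
  calc 0 ≤ s ^ 2 * (a - b * s + c * s ^ 2) := by positivity
    _ = a * s ^ 2 - b * s ^ 3 + c * (s ^ 2) ^ 2 := by ring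
    _ ≤ _ := by gcongr

lemma abs_bulkGrad_entry_le (a b c : ℝ) (A : Mat3) (i j : Fin 3) :
    |bulkGrad a b c A i j| ≤ (|a| + 2 * |b| + |c|) * (1 + ‖vec A‖ ^ 3) := by
  have h1 := abs_entry_le A i j
  have h2 := (abs_entry_le (A * A) i j).trans (norm_vec_mul_self_le A)
  have h3 : |(1 : Mat3) i j| ≤ 1 := by
    rw [Matrix.one_apply]
    split_ifs <;> simp
  have hs := norm_nonneg (vec A)
  simp only [bulkGrad, Matrix.add_apply, Matrix.sub_apply, Matrix.smul_apply, smul_eq_mul,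
    ← norm_vec_sq]
  set s := ‖vec A‖
  have e1 : s ≤ 1 + s ^ 3 := by nlinarith [sq_nonneg (s - 1), mul_nonneg hs (sq_nonneg (s - 1))]
  have e2 : s ^ 2 ≤ 1 + s ^ 3 := by nlinarith [sq_nonneg (s - 1), mul_nonneg hs (sq_nonneg (s - 1))]
  have t1 : |a * A i j| ≤ |a| * (1 + s ^ 3) := by
    rw [abs_mul]; gcongr; exact h1.trans e1
  have t2 : |b * (A * A) i j| ≤ |b| * (1 + s ^ 3) := by
    rw [abs_mul]; gcongr; exact h2.trans e2
  have t3 : |c * s ^ 2 * A i j| ≤ |c| * (1 + s ^ 3) := by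
    rw [mul_assoc, abs_mul, abs_mul, abs_of_nonneg (sq_nonneg s)]
    gcongr
    calc s ^ 2 * |A i j| ≤ s ^ 2 * s := by gcongr
      _ ≤ 1 + s ^ 3 := by nlinarith
  have t4 : |b / 3 * s ^ 2 * (1 : Mat3) i j| ≤ |b| * (1 + s ^ 3) := by
    rw [abs_mul, abs_mul, abs_of_nonneg (sq_nonneg s), abs_div,
      abs_of_pos (by norm_num : (0 : ℝ) < 3)]
    have := abs_nonneg b
    calc |b| / 3 * s ^ 2 * |(1 : Mat3) i j| ≤ |b| * (1 + s ^ 3) * 1 := by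
          gcongr
          linarith
      _ = _ := mul_one _
  have := abs_add_le (a * A i j - b * (A * A) i j + c * s ^ 2 * A i j)
    (b / 3 * s ^ 2 * (1 : Mat3) i j)
  have := abs_add_le (a * A i j - b * (A * A) i j) (c * s ^ 2 * A i j)
  have := abs_sub (a * A i j) (b * (A * A) i j)
  linarith

/-- The orthogonal projection of matrices onto Q-tensors. -/
def projQ (B : Mat3) : Mat3 := (1 / 2 : ℝ) • (B + B.transpose) - (B.trace / 3) • (1 : Mat3)

lemma projQ_mem (B : Mat3) : projQ B ∈ QTensor := by
  refine ⟨?_, ?_⟩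
  · simp [projQ, Matrix.transpose_sub, Matrix.transpose_smul, Matrix.transpose_add, add_comm]
  · simp [projQ, Matrix.trace_sub, Matrix.trace_smul, Matrix.trace_add]
    ring

lemma projQ_eq_self {A : Mat3} (hA : A ∈ QTensor) : projQ A = A := by
  rw [projQ, hA.1, hA.2, zero_div, zero_smul, sub_zero, ← two_smul ℝ A, smul_smul]
  norm_num

lemma dot_projQ_comm (A B : Mat3) : dot A (projQ B) = dot (projQ A) B := by
  simp only [projQ, dot, Matrix.add_apply, Matrix.sub_apply, Matrix.smul_apply, smul_eq_mul,
    Fin.sum_univ_three, Matrix.transpose_apply, Matrix.trace_fin_three, Matrix.one_apply]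
  simp
  ring

/-- Only Q-tensors are admissible tests, so the equation determines only the projection of the rate.
Self-adjointness shows that nothing is lost when the rate is paired with `Q`. -/
lemma dot_projQ {A : Mat3} (hA : A ∈ QTensor) (B : Mat3) : dot A (projQ B) = dot A B := by
  rw [dot_projQ_comm, projQ_eq_self hA]

lemma dot_single (A : Mat3) (i j : Fin 3) : dot A (Matrix.single i j 1) = A i j := by
  rw [dot, Finset.sum_eq_single i, Finset.sum_eq_single j]
  · simp
  · intro l _ hl
    simp [hl.symm]
  · simp
  · intro l _ hl
    simp [Matrix.single_apply_of_row_ne hl.symm]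
  · simp

end Algebra

/-! ### Static test tensors -/

section Tests

variable {Ω : Set E3}

lemma IsTestFunction.isH1With {φ : E3 → ℝ} (hφ : IsTestFunction Ω φ) :
    IsH1With Ω φ (fun x k => pderiv k φ x) where
  mem := (hφ.smooth.continuous.memLp_of_hasCompactSupport hφ.compact).restrict Ω
  mem_grad := hφ.memLp_pderiv
  weak k := by
    have hc : Continuous (pderiv k φ) :=
      (hφ.smooth.continuous_fderiv (by simp)).clm_apply continuous_const
    refine ⟨hφ.smooth.continuous.locallyIntegrable.locallyIntegrableOn Ω,
      hc.locallyIntegrable.locallyIntegrableOn Ω, fun ψ hψ => ?_⟩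
    have hcψ : Continuous (pderiv k ψ) :=
      (hψ.smooth.continuous_fderiv (by simp)).clm_apply continuous_const
    have h0 : ∀ x, x ∉ Ω → φ x = 0 := fun x hx =>
      image_eq_zero_of_notMem_tsupport fun h => hx (hφ.subset h)
    have h0' : ∀ x, x ∉ Ω → ψ x = 0 := fun x hx =>
      image_eq_zero_of_notMem_tsupport fun h => hx (hψ.subset h)
    rw [setIntegral_eq_integral_of_forall_compl_eq_zero fun x hx => by rw [h0 x hx, zero_mul],
      setIntegral_eq_integral_of_forall_compl_eq_zero fun x hx => by rw [h0' x hx, mul_zero]]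
    refine integral_mul_fderiv_eq_neg_fderiv_mul_of_integrable (μ := volume)
      (f := φ) (g := ψ) (v := EuclideanSpace.single k 1) ?_ ?_ ?_
      (fun x _ => hφ.smooth.differentiable (by simp) x)
      (fun x _ => hψ.smooth.differentiable (by simp) x)
    · exact (hc.mul hψ.smooth.continuous).integrable_of_hasCompactSupport hψ.compact.mul_left
    · exact (hφ.smooth.continuous.mul hcψ).integrable_of_hasCompactSupport hφ.compact.mul_right
    · exact (hφ.smooth.continuous.mul hψ.smooth.continuous).integrable_of_hasCompactSupport
        hφ.compact.mul_right

/-- Constancy in time removes the `∂ₜΨ` term and leaves the values of `Q` at the two endpoints,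
which is the equation in integrated form. -/
lemma isTensorTest_static {φ : E3 → ℝ} (hφ : IsTestFunction Ω φ)
    {A : Mat3} (hA : A ∈ QTensor) (T : ℝ) :
    IsTensorTest Ω T (fun _ x => φ x • A)
      (fun _ x i j k => pderiv k (fun y => φ y * A i j) x) (fun _ _ => 0)
      (fun _ _ _ _ _ => 0) where
  tensor t _ := .of_forall fun x => by
    refine ⟨?_, ?_⟩
    · rw [Matrix.transpose_smul, hA.1]
    · rw [Matrix.trace_smul, hA.2, smul_zero]
  tensor_deriv t _ := .of_forall fun x => by simp [QTensor]
  mem t _ i j :=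
    IsTestFunction.isH1With (φ := fun y => φ y * A i j)
      ⟨hφ.smooth.mul contDiff_const, hφ.compact.mul_right,
      (tsupport_mul_subset_left (f := φ)).trans hφ.subset⟩
  mem_deriv t _ i j := by
    have h := IsTestFunction.isH1With (Ω := Ω) (φ := fun _ => (0 : ℝ)) ⟨contDiff_const, .zero, by
      simp [tsupport]⟩
    simpa [pderiv] using h
  c1 i j :=
    { hasDeriv := fun t _ => by simpa [h1Norm] using tendsto_const_nhds
      cont_deriv := fun t _ => by simpa [h1Norm] using tendsto_const_nhds }

end Tests

/-! ### Weak solutions -/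

section Solutions

variable {Ω : Set E3}

lemma restrict_prod_eq (Ω : Set E3) (T : ℝ) :
    (volume.restrict (Ω ×ˢ Ioo 0 T) : Measure (E3 × ℝ))
      = (volume.restrict Ω).prod (volume.restrict (Ioo 0 T)) := by
  rw [Measure.prod_restrict, Measure.volume_eq_prod]

lemma IsSmoothBoundedDomain.isFiniteMeasure (hΩ : IsSmoothBoundedDomain Ω) :
    IsFiniteMeasure (volume.restrict Ω : Measure E3) :=
  ⟨by simpa using hΩ.isBounded.measure_lt_top⟩

variable {a b c ε T₁ : ℝ} {v₀ : E3 → E3} {Q₀ : E3 → Mat3} {v : ℝ → E3 → E3}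
  {Dv : ℝ → E3 → Mat3} {Q : ℝ → E3 → Mat3} {DQ : ℝ → E3 → Fin 3 → Fin 3 → Fin 3 → ℝ}
  {D2Q : ℝ → E3 → Fin 3 → Fin 3 → Fin 3 → Fin 3 → ℝ} {T : ℝ}

lemma continuous_bulkGrad_entry (a b c : ℝ) (i j : Fin 3) :
    Continuous fun y : EuclideanSpace ℝ (Fin 3 × Fin 3) =>
      bulkGrad a b c (Matrix.of fun k l => y (k, l)) i j := by
  simp only [bulkGrad, dot, Matrix.add_apply, Matrix.sub_apply, Matrix.smul_apply, smul_eq_mul,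
    Matrix.mul_apply, Matrix.of_apply]
  fun_prop

namespace IsWeakSolutionWith

/-- The `H¹` norm is bounded uniformly in time and the Dirichlet condition puts each slice in `H¹₀`,
so the Sobolev bound is uniform over slices. The exponent `3` is the degree of `DF`. -/
lemma memLp_three (hsol : IsWeakSolutionWith Ω a b c ε T₁ v₀ Q₀ v Dv Q DQ D2Q)
    (hΩ : IsSmoothBoundedDomain Ω) (hT : T ∈ Ioo 0 T₁) :
    MemLp (fun p : E3 × ℝ => vec (Q p.2 p.1)) 3
      ((volume.restrict Ω).prod (volume.restrict (Ioo 0 T))) := by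
  rw [memLp_piLp_iff]
  rintro ⟨i, j⟩
  obtain ⟨hBC, hH2⟩ := hsol.regularity_Q T hT i j
  obtain ⟨C, hC⟩ := exists_eLpNorm_three_le_h1Norm hΩ.isBounded
  obtain ⟨K, hK⟩ := hBC.bounded
  refine memLp_prod_of_eLpNorm_slice_le (u := fun t x => Q t x i j)
    (M := C * ENNReal.ofReal K) (ENNReal.mul_ne_top ENNReal.coe_ne_top ENNReal.ofReal_ne_top) ?_ ?_
  · rw [← restrict_prod_eq]
    exact hH2.mem.1
  · filter_upwards [ae_restrict_mem measurableSet_Ioo] with t ht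
    refine (hC _ _ (hsol.boundary_Q t ⟨ht.1, ht.2.trans hT.2⟩ i j)).trans ?_
    gcongr
    exact hK t ⟨ht.1.le, ht.2.le⟩

lemma aestronglyMeasurable_vec (hsol : IsWeakSolutionWith Ω a b c ε T₁ v₀ Q₀ v Dv Q DQ D2Q)
    (hΩ : IsSmoothBoundedDomain Ω) (hT : T ∈ Ioo 0 T₁) :
    AEStronglyMeasurable (fun p : E3 × ℝ => vec (Q p.2 p.1))
      ((volume.restrict Ω).prod (volume.restrict (Ioo 0 T))) :=
  (hsol.memLp_three hΩ hT).1

lemma integrable_bulkGrad (hsol : IsWeakSolutionWith Ω a b c ε T₁ v₀ Q₀ v Dv Q DQ D2Q)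
    (hΩ : IsSmoothBoundedDomain Ω) (hT : T ∈ Ioo 0 T₁) (i j : Fin 3) :
    Integrable (fun p : E3 × ℝ => bulkGrad a b c (Q p.2 p.1) i j)
      ((volume.restrict Ω).prod (volume.restrict (Ioo 0 T))) := by
  have := hΩ.isFiniteMeasure
  have h3 := hsol.memLp_three hΩ hT
  have hpow : Integrable (fun p : E3 × ℝ => ‖vec (Q p.2 p.1)‖ ^ 3)
      ((volume.restrict Ω).prod (volume.restrict (Ioo 0 T))) :=
    MemLp.integrable_norm_pow (p := 3) (by exact_mod_cast h3) (by norm_num)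
  have hint : Integrable (fun p : E3 × ℝ => (|a| + 2 * |b| + |c|) * (1 + ‖vec (Q p.2 p.1)‖ ^ 3))
      ((volume.restrict Ω).prod (volume.restrict (Ioo 0 T))) :=
    ((integrable_const 1).add hpow).const_mul _
  have hm := (continuous_bulkGrad_entry a b c i j).comp_aestronglyMeasurable h3.1
  exact hint.mono' hm (.of_forall fun p => abs_bulkGrad_entry_le a b c _ i j)

lemma integrable_lap (hsol : IsWeakSolutionWith Ω a b c ε T₁ v₀ Q₀ v Dv Q DQ D2Q)
    (hΩ : IsSmoothBoundedDomain Ω) (hT : T ∈ Ioo 0 T₁) (i j : Fin 3) :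
    Integrable (fun p : E3 × ℝ => lap (D2Q p.2 p.1) i j)
      ((volume.restrict Ω).prod (volume.restrict (Ioo 0 T))) := by
  have := hΩ.isFiniteMeasure
  refine integrable_finsetSum _ fun k _ => ?_
  have h := (hsol.regularity_Q T hT i j).2.mem_hess k k
  rw [MemL2L2, restrict_prod_eq] at h
  exact h.integrable (by norm_num)

/-- A product of two `L²` functions: integrability is all that is obtained, which is why the penalty
must have bounded gradient. -/
lemma integrable_advect (hsol : IsWeakSolutionWith Ω a b c ε T₁ v₀ Q₀ v Dv Q DQ D2Q)
    (hT : T ∈ Ioo 0 T₁) (i j : Fin 3) :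
    Integrable (fun p : E3 × ℝ => advect (v p.2 p.1) (DQ p.2 p.1) i j)
      ((volume.restrict Ω).prod (volume.restrict (Ioo 0 T))) := by
  refine integrable_finsetSum _ fun k _ => ?_
  have h1 := (hsol.regularity_Q T hT i j).2.mem_grad k
  have h2 := (hsol.regularity_v T hT).2.mem k
  rw [MemL2L2, restrict_prod_eq] at h1 h2
  exact h2.integrable_mul h1

end IsWeakSolutionWith

/-- The time derivative `ΔQ - ε⁻² DF(Q) - (v · ∇) Q` prescribed by the Q-tensor equation. -/
def rate (a b c ε : ℝ) (v : ℝ → E3 → E3) (Q : ℝ → E3 → Mat3)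
    (DQ : ℝ → E3 → Fin 3 → Fin 3 → Fin 3 → ℝ)
    (D2Q : ℝ → E3 → Fin 3 → Fin 3 → Fin 3 → Fin 3 → ℝ) (p : E3 × ℝ) : Mat3 :=
  (lap (D2Q p.2 p.1) - (1 / ε ^ 2) • bulkGrad a b c (Q p.2 p.1)) - advect (v p.2 p.1) (DQ p.2 p.1)

lemma integrable_dot_left {X : Type*} [MeasurableSpace X] {μ : Measure X} {H : X → Mat3}
    (hH : ∀ i j, Integrable (fun x => H x i j) μ) (A : Mat3) :
    Integrable (fun x => dot (H x) A) μ :=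
  integrable_finsetSum _ fun i _ => integrable_finsetSum _ fun j _ => (hH i j).mul_const _

lemma dot_sub_left (A B C : Mat3) : dot (A - B) C = dot A C - dot B C := by
  simp [dot, sub_mul, Finset.sum_sub_distrib]

lemma dot_sub_right (A B C : Mat3) : dot A (B - C) = dot A B - dot A C := by
  simp [dot, mul_sub, Finset.sum_sub_distrib]

lemma dot_smul_right (r : ℝ) (A B : Mat3) : dot A (r • B) = r * dot A B := by
  simp [dot, Finset.mul_sum, mul_left_comm]

namespace IsWeakSolutionWith

lemma integrable_rate (hsol : IsWeakSolutionWith Ω a b c ε T₁ v₀ Q₀ v Dv Q DQ D2Q)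
    (hΩ : IsSmoothBoundedDomain Ω) (hT : T ∈ Ioo 0 T₁) (i j : Fin 3) :
    Integrable (fun p : E3 × ℝ => rate a b c ε v Q DQ D2Q p i j)
      ((volume.restrict Ω).prod (volume.restrict (Ioo 0 T))) :=
  ((hsol.integrable_lap hΩ hT i j).sub ((hsol.integrable_bulkGrad hΩ hT i j).const_mul _)).sub
    (hsol.integrable_advect hT i j)

/-- The Q-tensor equation integrated in time, paired with a constant Q-tensor. -/
lemma ae_dot_sub_eq_integral (hsol : IsWeakSolutionWith Ω a b c ε T₁ v₀ Q₀ v Dv Q DQ D2Q)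
    (hΩ : IsSmoothBoundedDomain Ω) (hT : T ∈ Ioo 0 T₁) {A : Mat3} (hA : A ∈ QTensor) :
    ∀ᵐ x ∂(volume.restrict Ω), dot (Q T x) A - dot (Q 0 x) A
      = ∫ t in (0 : ℝ)..T, dot (rate a b c ε v Q DQ D2Q (x, t)) A := by
  have := hΩ.isFiniteMeasure
  have hT0 : (0 : ℝ) ≤ T := hT.1.le
  have hQt : ∀ t ∈ Icc 0 T, Integrable (fun x => dot (Q t x) A) (volume.restrict Ω) :=
    fun t ht => integrable_dot_left (fun i j =>
      (((hsol.regularity_Q T hT i j).1.mem t ht).mem.integrable (by norm_num))) A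
  have hQT := hQt T ⟨hT0, le_rfl⟩
  have hQ0 := hQt 0 ⟨le_rfl, hT0⟩
  have hG := integrable_dot_left (fun i j => hsol.integrable_rate hΩ hT i j) A
  have hG1 : Integrable (fun p : E3 × ℝ =>
      dot (lap (D2Q p.2 p.1) - (1 / ε ^ 2) • bulkGrad a b c (Q p.2 p.1)) A)
      ((volume.restrict Ω).prod (volume.restrict (Ioo 0 T))) :=
    integrable_dot_left (fun i j => (hsol.integrable_lap hΩ hT i j).sub
      ((hsol.integrable_bulkGrad hΩ hT i j).const_mul _)) A
  have hG2 := integrable_dot_left (fun i j => hsol.integrable_advect hT i j) A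
  have hGx : Integrable (fun x => ∫ t in (0 : ℝ)..T, dot (rate a b c ε v Q DQ D2Q (x, t)) A)
      (volume.restrict Ω) := by
    simp only [intervalIntegral.integral_of_le hT0, integral_Ioc_eq_integral_Ioo]
    exact hG.integral_prod_left
  have hf : Integrable (fun x => dot (Q T x) A - dot (Q 0 x) A
      - ∫ t in (0 : ℝ)..T, dot (rate a b c ε v Q DQ D2Q (x, t)) A) (volume.restrict Ω) :=
    (hQT.sub hQ0).sub hGx
  have key : ∀ᵐ x ∂(volume : Measure E3), x ∈ Ω → dot (Q T x) A - dot (Q 0 x) A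
      - ∫ t in (0 : ℝ)..T, dot (rate a b c ε v Q DQ D2Q (x, t)) A = 0 := by
    -- The fundamental lemma of the calculus of variations: the spatial factor `φ` of the static
    -- test localises the identity.
    refine hΩ.isOpen.ae_eq_zero_of_integral_contDiff_smul_eq_zero
      (IntegrableOn.locallyIntegrableOn hf) fun φ h1 h2 h3 => ?_
    have hφ : IsTestFunction Ω φ := ⟨h1, h2, h3⟩
    have h0 : ∀ x, x ∉ Ω → φ x = 0 := fun x hx =>
      image_eq_zero_of_notMem_tsupport fun h => hx (h3 h)
    obtain ⟨C, hC⟩ := h1.continuous.bounded_above_of_compact_support h2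
    have hmul : ∀ {f : E3 → ℝ}, Integrable f (volume.restrict Ω) →
        Integrable (fun x => φ x * f x) (volume.restrict Ω) := fun hf =>
      hf.bdd_mul h1.continuous.aestronglyMeasurable (.of_forall hC)
    have hmul' : ∀ {f : E3 × ℝ → ℝ},
        Integrable f ((volume.restrict Ω).prod (volume.restrict (Ioo 0 T))) →
        Integrable (fun p => φ p.1 * f p)
          ((volume.restrict Ω).prod (volume.restrict (Ioo 0 T))) := fun hf =>
      hf.bdd_mul (h1.continuous.comp continuous_fst).aestronglyMeasurable
        (.of_forall fun p => hC p.1)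
    have hid := hsol.tensor_eq T hT _ _ _ _ (isTensorTest_static hφ hA T)
    simp only [TensorIdentity, dot_smul_right, intervalIntegral.integral_of_le hT0,
      integral_Ioc_eq_integral_Ioo] at hid
    have hz : ∀ B : Mat3, dot B 0 = 0 := fun B => by simp [dot]
    simp only [hz, integral_zero, sub_zero] at hid
    rw [← integral_prod_symm (fun p : E3 × ℝ => φ p.1 * dot (advect (v p.2 p.1) (DQ p.2 p.1)) A)
        (hmul' hG2),
      ← integral_prod_symm (fun p : E3 × ℝ => φ p.1 *
        dot (lap (D2Q p.2 p.1) - (1 / ε ^ 2) • bulkGrad a b c (Q p.2 p.1)) A) (hmul' hG1),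
      ← eq_sub_iff_add_eq, ← integral_sub (hmul' hG1) (hmul' hG2)] at hid
    have hrate : ∀ p : E3 × ℝ, φ p.1 *
        dot (lap (D2Q p.2 p.1) - (1 / ε ^ 2) • bulkGrad a b c (Q p.2 p.1)) A
        - φ p.1 * dot (advect (v p.2 p.1) (DQ p.2 p.1)) A
        = φ p.1 * dot (rate a b c ε v Q DQ D2Q p) A := fun p => by
      rw [rate, dot_sub_left _ (advect _ _), mul_sub]
    simp only [hrate] at hid
    rw [integral_prod _ (hmul' hG)] at hid
    simp only [integral_const_mul] at hid
    rw [← setIntegral_eq_integral_of_forall_compl_eq_zero (s := Ω)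
      fun x hx => by rw [h0 x hx, zero_smul]]
    simp only [smul_eq_mul, mul_sub]
    have hsub : Integrable (fun x => φ x * dot (Q T x) A - φ x * dot (Q 0 x) A)
        (volume.restrict Ω) := (hmul hQT).sub (hmul hQ0)
    rw [integral_sub hsub (hmul hGx), integral_sub (hmul hQT) (hmul hQ0),
      hid, sub_eq_zero]
    simp only [intervalIntegral.integral_of_le hT0, integral_Ioc_eq_integral_Ioo]
  filter_upwards [(ae_restrict_iff' hΩ.isOpen.measurableSet).2 key] with x hx
  exact sub_eq_zero.1 hx

/-- The Q-tensor equation integrated in time, at almost every point. -/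
lemma ae_vec_eq (hsol : IsWeakSolutionWith Ω a b c ε T₁ v₀ Q₀ v Dv Q DQ D2Q)
    (hΩ : IsSmoothBoundedDomain Ω) (hT : T ∈ Ioo 0 T₁) :
    ∀ᵐ x ∂(volume.restrict Ω), vec (Q T x) = vec (Q 0 x)
      + ∫ t in (0 : ℝ)..T, vec (projQ (rate a b c ε v Q DQ D2Q (x, t))) := by
  have h1 : ∀ᵐ x ∂(volume.restrict Ω), ∀ i j, Q T x i j - Q 0 x i j
      = ∫ t in (0 : ℝ)..T, projQ (rate a b c ε v Q DQ D2Q (x, t)) i j := by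
    refine ae_all_iff.2 fun i => ae_all_iff.2 fun j => ?_
    -- Testing with the projected matrix unit reads off one entry, since the projection is
    -- self-adjoint and fixes `Q T x` and `Q 0 x`.
    filter_upwards [hsol.ae_dot_sub_eq_integral hΩ hT (projQ_mem (Matrix.single i j 1)),
      hsol.tensor T ⟨hT.1.le, hT.2⟩, hsol.tensor 0 ⟨le_rfl, hT.1.trans hT.2⟩] with x hx hQT hQ0
    simpa only [dot_projQ_comm, dot_single, projQ_eq_self hQT, projQ_eq_self hQ0] using hx
  have h2 : ∀ᵐ x ∂(volume.restrict Ω), ∀ i j, Integrable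
      (fun t => projQ (rate a b c ε v Q DQ D2Q (x, t)) i j) (volume.restrict (Ioo 0 T)) := by
    refine ae_all_iff.2 fun i => ae_all_iff.2 fun j => ?_
    have hG := integrable_dot_left (fun i j => hsol.integrable_rate hΩ hT i j)
      (projQ (Matrix.single i j 1))
    simp only [dot_projQ_comm, dot_single] at hG
    exact hG.prod_right_ae
  filter_upwards [h1, h2] with x hx hi
  ext ⟨i, j⟩
  rw [intervalIntegral.integral_of_le hT.1.le, integral_Ioc_eq_integral_Ioo, PiLp.add_apply,
    eval_integral_piLp (fun p => hi p.1 p.2), vec_apply, vec_apply, ← sub_eq_iff_eq_add', hx i j,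
    intervalIntegral.integral_of_le hT.1.le, integral_Ioc_eq_integral_Ioo]
  rfl

end IsWeakSolutionWith

end Solutions

/-! ### The maximum principle -/

section MaximumPrinciple

variable {Ω : Set E3} {a b c ε T₁ c₀ : ℝ} {v₀ : E3 → E3} {Q₀ : E3 → Mat3} {v : ℝ → E3 → E3}
  {Dv : ℝ → E3 → Mat3} {Q : ℝ → E3 → Mat3} {DQ : ℝ → E3 → Fin 3 → Fin 3 → Fin 3 → ℝ}
  {D2Q : ℝ → E3 → Fin 3 → Fin 3 → Fin 3 → Fin 3 → ℝ} {T : ℝ}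

/-- Passing from slices to the product requires a measurable set, so the bound is transferred to a
measurable representative and back. -/
lemma ae_prod_le_of_ae_ae_le {X Y : Type*} [MeasurableSpace X] [MeasurableSpace Y] {μ : Measure X}
    {ν : Measure Y} [SFinite μ] [SFinite ν] {f : X × Y → ℝ} (hf : AEMeasurable f (μ.prod ν)) {r : ℝ}
    (h : ∀ᵐ y ∂ν, ∀ᵐ x ∂μ, f (x, y) ≤ r) : ∀ᵐ p ∂(μ.prod ν), f p ≤ r := by
  have hswap : ∀ᵐ y ∂ν, ∀ᵐ x ∂μ, f (x, y) = hf.mk f (x, y) :=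
    Measure.ae_ae_of_ae_prod (μ := ν) (ν := μ)
      (p := fun q : Y × X => f (q.2, q.1) = hf.mk f (q.2, q.1))
      (Measure.measurePreserving_swap.quasiMeasurePreserving.ae hf.ae_eq_mk)
  have hm : MeasurableSet {p : X × Y | hf.mk f p ≤ r} :=
    measurableSet_le hf.measurable_mk measurable_const
  have h1 : ∀ᵐ p ∂(μ.prod ν), hf.mk f p ≤ r := by
    rw [Measure.ae_prod_iff_ae_ae hm, Measure.ae_ae_comm (p := fun x y => hf.mk f (x, y) ≤ r) hm]
    filter_upwards [h, hswap] with y h1 h2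
    filter_upwards [h1, h2] with x h3 h4
    rwa [← h4]
  filter_upwards [h1, hf.ae_eq_mk] with p h2 h3
  rwa [h3]

lemma integrable_penaltyCoef_mul_dot {X : Type*} [MeasurableSpace X] {μ : Measure X}
    {A H : X → Mat3} (hA : AEStronglyMeasurable (fun x => vec (A x)) μ)
    (hH : ∀ i j, Integrable (fun x => H x i j) μ) (c₀ : ℝ) :
    Integrable (fun x => penaltyCoef c₀ (vec (A x)) * dot (A x) (H x)) μ := by
  simp only [dot, Finset.mul_sum, ← mul_assoc]
  refine integrable_finsetSum _ fun i _ => integrable_finsetSum _ fun j _ => ?_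
  exact (hH i j).bdd_mul ((continuous_penaltyCoef_mul_apply c₀ (i, j)).comp_aestronglyMeasurable hA)
    (.of_forall fun x => abs_penaltyCoef_mul_apply_le c₀ (vec (A x)) (i, j))

namespace IsWeakSolutionWith

/-- At almost every time, the integral of the penalty does not increase. -/
lemma ae_integral_penaltyCoef_mul_dot_rate_nonpos
    (hsol : IsWeakSolutionWith Ω a b c ε T₁ v₀ Q₀ v Dv Q DQ D2Q)
    (hΩ : IsSmoothBoundedDomain Ω) (hb : 0 < b) (hc : 0 < c) (hc₀ : 0 < c₀)
    (hμ : b ^ 2 / c ^ 2 - 2 * a / c ≤ c₀ ^ 2) (hT : T ∈ Ioo 0 T₁) :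
    ∀ᵐ t ∂(volume.restrict (Ioo 0 T)), ∫ x in Ω, penaltyCoef c₀ (vec (Q t x)) *
      dot (Q t x) (rate a b c ε v Q DQ D2Q (x, t)) ≤ 0 := by
  have := hΩ.isFiniteMeasure
  have hQm := hsol.aestronglyMeasurable_vec hΩ hT
  have h1 := (integrable_penaltyCoef_mul_dot hQm
    (fun i j => hsol.integrable_lap hΩ hT i j) c₀).prod_left_ae
  have h2 := (integrable_penaltyCoef_mul_dot hQm
    (fun i j => hsol.integrable_bulkGrad hΩ hT i j) c₀).prod_left_ae
  have h3 := (integrable_penaltyCoef_mul_dot hQm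
    (fun i j => hsol.integrable_advect hT i j) c₀).prod_left_ae
  have hH2 : ∀ᵐ t ∂(volume.restrict (Ioo 0 T)), ∀ i j k,
      IsH1With Ω (fun x => DQ t x i j k) (fun x => D2Q t x i j k) := by
    refine ae_all_iff.2 fun i => ae_all_iff.2 fun j => ?_
    filter_upwards [(hsol.regularity_Q T hT i j).2.slice] with t ht
    exact ht.2
  filter_upwards [h1, h2, h3, hH2, ae_restrict_mem measurableSet_Ioo] with t i1 i2 i3 hD2 ht
  have htT : t ∈ Ioo 0 T₁ := ⟨ht.1, ht.2.trans hT.2⟩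
  have hH10 : ∀ p : Fin 3 × Fin 3, IsH10With Ω (fun x => vec (Q t x) p)
      (fun x => DQ t x p.1 p.2) := fun p => hsol.boundary_Q t htT p.1 p.2
  have e1 : ∫ x in Ω, penaltyCoef c₀ (vec (Q t x)) * dot (Q t x) (lap (D2Q t x)) ≤ 0 := by
    refine le_trans (le_of_eq ?_) (integral_laplacian_penalty_nonpos c₀ hH10
      (D2 := fun x p => D2Q t x p.1 p.2) fun p k => hD2 p.1 p.2 k)
    congr with x
    simp only [dot, lap, Fintype.sum_prod_type, Finset.mul_sum, vec_apply]
    exact Finset.sum_congr rfl fun i _ => Finset.sum_congr rfl fun j _ =>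
      Finset.sum_congr rfl fun k _ => by ring
  have e2 : 0 ≤ ∫ x in Ω, penaltyCoef c₀ (vec (Q t x)) *
      dot (Q t x) (bulkGrad a b c (Q t x)) := by
    refine integral_nonneg_of_ae ?_
    filter_upwards [hsol.tensor t ⟨htT.1.le, htT.2⟩] with x hx
    -- Inside the ball the coefficient vanishes, so the sign of the bulk force is needed only
    -- outside.
    rcases le_total ‖vec (Q t x)‖ c₀ with h | h
    · simp [penaltyCoef_eq_zero hc₀.le h]
    · exact mul_nonneg (penaltyCoef_nonneg _ _) (dot_bulkGrad_nonneg hb hc hc₀ hμ hx h)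
  have e3 : ∫ x in Ω, penaltyCoef c₀ (vec (Q t x)) *
      dot (Q t x) (advect (v t x) (DQ t x)) = 0 := by
    rw [← integral_transport_penalty_eq_zero hc₀.le
      ((hsol.regularity_v T hT).1.mem t ⟨ht.1.le, ht.2.le⟩) hH10]
    congr with x
    rw [Finset.sum_comm]
    simp only [dot, advect, Fintype.sum_prod_type, Finset.mul_sum, vec_apply]
    exact Finset.sum_congr rfl fun i _ => Finset.sum_congr rfl fun j _ =>
      Finset.sum_congr rfl fun k _ => by ring
  have hsplit : ∀ x, penaltyCoef c₀ (vec (Q t x)) * dot (Q t x) (rate a b c ε v Q DQ D2Q (x, t))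
      = penaltyCoef c₀ (vec (Q t x)) * dot (Q t x) (lap (D2Q t x))
        - 1 / ε ^ 2 * (penaltyCoef c₀ (vec (Q t x)) * dot (Q t x) (bulkGrad a b c (Q t x)))
        - penaltyCoef c₀ (vec (Q t x)) * dot (Q t x) (advect (v t x) (DQ t x)) := fun x => by
    rw [rate, dot_sub_right, dot_sub_right, dot_smul_right]
    ring
  have i2' := i2.const_mul (1 / ε ^ 2)
  have i12 := i1.sub i2'
  simp only [hsplit]
  have s1 := integral_sub i12 i3
  have s2 := integral_sub i1 i2'
  simp only [Pi.sub_apply] at s1 s2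
  rw [s1, s2, integral_const_mul, e3]
  have : 0 ≤ 1 / ε ^ 2 * ∫ x in Ω, penaltyCoef c₀ (vec (Q t x)) *
      dot (Q t x) (bulkGrad a b c (Q t x)) := mul_nonneg (by positivity) e2
  linarith

/-- The maximum principle at each time. -/
theorem ae_norm_vec_le (hsol : IsWeakSolutionWith Ω a b c ε T₁ v₀ Q₀ v Dv Q DQ D2Q)
    (hΩ : IsSmoothBoundedDomain Ω) (hb : 0 < b) (hc : 0 < c) (hc₀ : 0 < c₀)
    (hμ : b ^ 2 / c ^ 2 - 2 * a / c ≤ c₀ ^ 2)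
    (hQ₀ : ∀ᵐ x ∂(volume.restrict Ω), ‖vec (Q₀ x)‖ ≤ c₀) (hT : T ∈ Ioo 0 T₁) :
    ∀ᵐ x ∂(volume.restrict Ω), ‖vec (Q T x)‖ ≤ c₀ := by
  have := hΩ.isFiniteMeasure
  have hT0 : (0 : ℝ) ≤ T := hT.1.le
  have hQm := hsol.aestronglyMeasurable_vec hΩ hT
  have hQ0m : AEStronglyMeasurable (fun x => vec (Q 0 x)) (volume.restrict Ω) :=
    ((memLp_piLp_iff (p := 2) (f := fun x => vec (Q 0 x))).2 fun p =>
      ((hsol.regularity_Q T hT p.1 p.2).1.mem 0 ⟨le_rfl, hT0⟩).mem).1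
  have hG : Integrable (fun p : E3 × ℝ => vec (projQ (rate a b c ε v Q DQ D2Q p)))
      ((volume.restrict Ω).prod (volume.restrict (Ioo 0 T))) := by
    rw [integrable_piLp_iff]
    rintro ⟨i, j⟩
    have hG := integrable_dot_left (fun i j => hsol.integrable_rate hΩ hT i j)
      (projQ (Matrix.single i j 1))
    simpa only [dot_projQ_comm, dot_single, vec_apply] using hG
  have hchain := ae_sub_eq_integral_fderiv (u := fun t x => vec (Q t x)) hT.1 hQm hQ0m hG
    (fun t ht => hsol.ae_vec_eq hΩ ⟨ht.1, ht.2.trans_lt hT.2⟩) (lipschitzWith_penalty c₀)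
    ((contDiff_penalty c₀).differentiable (by simp))
  -- Bounded gradient times integrable rate: this licenses exchanging the space and time integrals
  -- below.
  have hI : Integrable (fun p : E3 × ℝ => penaltyCoef c₀ (vec (Q p.2 p.1)) *
      dot (Q p.2 p.1) (projQ (rate a b c ε v Q DQ D2Q p)))
      ((volume.restrict Ω).prod (volume.restrict (Ioo 0 T))) :=
    integrable_penaltyCoef_mul_dot hQm (fun i j => (integrable_piLp_iff.1 hG) (i, j)) c₀
  have hpen : ∀ᵐ x ∂(volume.restrict Ω), penalty c₀ (vec (Q T x))
      = ∫ t in Ioo 0 T, penaltyCoef c₀ (vec (Q t x)) *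
        dot (Q t x) (projQ (rate a b c ε v Q DQ D2Q (x, t))) := by
    filter_upwards [hchain, hQ₀, hsol.initial_Q] with x hx h0 hQ
    rw [hQ, (penalty_eq_zero_iff hc₀.le _).2 h0, sub_zero, intervalIntegral.integral_of_le hT0,
      integral_Ioc_eq_integral_Ioo] at hx
    rw [hx]
    congr with t
    rw [(hasFDerivAt_penalty c₀ _).fderiv, smul_apply, innerSL_apply_apply, inner_vec, smul_eq_mul]
  have hle : ∫ x in Ω, penalty c₀ (vec (Q T x)) ≤ 0 := by
    rw [integral_congr_ae hpen, integral_integral_swap hI]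
    refine integral_nonpos_of_ae ?_
    filter_upwards [hsol.ae_integral_penaltyCoef_mul_dot_rate_nonpos hΩ hb hc hc₀ hμ hT,
      ae_restrict_mem measurableSet_Ioo] with t ht htT
    refine le_trans (le_of_eq (integral_congr_ae ?_)) ht
    filter_upwards [hsol.tensor t ⟨htT.1.le, htT.2.trans hT.2⟩] with x hx
    rw [dot_projQ hx]
  have hpos : ∀ x, 0 ≤ penalty c₀ (vec (Q T x)) := fun x => ramp_nonneg _
  have hint : Integrable (fun x => penalty c₀ (vec (Q T x))) (volume.restrict Ω) :=
    hI.integral_prod_left.congr (hpen.mono fun x hx => hx.symm)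
  -- A nonnegative penalty with nonpositive integral vanishes almost everywhere, and its zero set is
  -- the ball.
  have hz := (integral_eq_zero_iff_of_nonneg hpos hint).1
    (le_antisymm hle (integral_nonneg hpos))
  filter_upwards [hz] with x hx
  exact (penalty_eq_zero_iff hc₀.le _).1 hx

end IsWeakSolutionWith

lemma ae_norm_vec_le_of_eLpNorm_sq_le (hc₀ : 0 ≤ c₀)
    (hQ₀ : eLpNorm (fun x => frobNorm (Q₀ x)) ⊤ (volume.restrict Ω) ^ 2 ≤
      ENNReal.ofReal (c₀ ^ 2)) :
    ∀ᵐ x ∂(volume.restrict Ω), ‖vec (Q₀ x)‖ ≤ c₀ := by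
  rw [ENNReal.ofReal_pow hc₀] at hQ₀
  have h1 : eLpNorm (fun x => frobNorm (Q₀ x)) ⊤ (volume.restrict Ω) ≤ ENNReal.ofReal c₀ :=
    le_of_not_gt fun h => absurd hQ₀ (not_le.2 (ENNReal.pow_lt_pow_left two_ne_zero h))
  rw [eLpNorm_exponent_top] at h1
  filter_upwards [ae_le_eLpNormEssSup (f := fun x => frobNorm (Q₀ x))
    (μ := volume.restrict Ω)] with x hx
  have h2 := hx.trans h1
  rw [← norm_vec, enorm_norm, ← ofReal_norm] at h2
  exact (ENNReal.ofReal_le_ofReal_iff hc₀).1 h2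

end MaximumPrinciple

end BerisEdwards

end

/-! ### From the bound at each time to the space-time bound -/

theorem lemma2p4 (Ω : Set BerisEdwards.E3) (hΩ : BerisEdwards.IsSmoothBoundedDomain Ω)
    (a b c : ℝ) (ha : 0 < a) (hb : 0 < b) (hc : 0 < c)
    (c₀ : ℝ) (hc₀ : 0 < c₀) (hμ : b ^ 2 / c ^ 2 - 2 * a / c ≤ c₀ ^ 2)
    (ε : ℝ) (hε : 0 < ε) (T₁ : ℝ) (hT₁ : 0 < T₁)
    (v₀ : BerisEdwards.E3 → BerisEdwards.E3) (Q₀ : BerisEdwards.E3 → BerisEdwards.Mat3)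
    (hQ₀ : eLpNorm (fun x => BerisEdwards.frobNorm (Q₀ x)) ∞ (volume.restrict Ω) ^ 2 ≤
      ENNReal.ofReal (c₀ ^ 2))
    (v : ℝ → BerisEdwards.E3 → BerisEdwards.E3) (Q : ℝ → BerisEdwards.E3 → BerisEdwards.Mat3)
    (hsol : BerisEdwards.IsWeakSolution Ω a b c ε T₁ v₀ Q₀ v Q) :
    eLpNorm (fun p : BerisEdwards.E3 × ℝ => BerisEdwards.frobNorm (Q p.2 p.1)) ∞
      (volume.restrict (Ω ×ˢ Ioo 0 T₁)) ≤ ENNReal.ofReal c₀ := by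
  obtain ⟨Dv, DQ, D2Q, hsol⟩ := hsol
  have h0 := BerisEdwards.ae_norm_vec_le_of_eLpNorm_sq_le hc₀.le hQ₀
  have hlocal : ∀ T ∈ Ioo 0 T₁, ∀ᵐ p ∂(volume.restrict (Ω ×ˢ Ioo 0 T)),
      BerisEdwards.frobNorm (Q p.2 p.1) ≤ c₀ := by
    intro T hT
    rw [BerisEdwards.restrict_prod_eq]
    simp only [← BerisEdwards.norm_vec]
    refine BerisEdwards.ae_prod_le_of_ae_ae_le
      (hsol.aestronglyMeasurable_vec hΩ hT).norm.aemeasurable ?_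
    filter_upwards [ae_restrict_mem measurableSet_Ioo] with t ht
    exact hsol.ae_norm_vec_le hΩ hb hc hc₀ hμ h0 ⟨ht.1, ht.2.trans hT.2⟩
  -- The regularity of the solution is given only on `[0, T]` with `T < T₁`, so the cylinder is
  -- exhausted by countably many shorter ones.
  obtain ⟨τ, -, hτ, hlim⟩ := exists_seq_strictMono_tendsto' hT₁
  have hcover : Ω ×ˢ Ioo 0 T₁ = ⋃ n, Ω ×ˢ Ioo 0 (τ n) := by
    ext ⟨x, t⟩
    simp only [mem_prod, mem_Ioo, mem_iUnion]
    refine ⟨fun ⟨hx, ht0, ht⟩ => ?_, fun ⟨n, hx, ht0, ht⟩ => ⟨hx, ht0, ht.trans (hτ n).2⟩⟩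
    obtain ⟨n, hn⟩ := (hlim.eventually (lt_mem_nhds ht)).exists
    exact ⟨n, hx, ht0, hn⟩
  rw [eLpNorm_exponent_top, hcover]
  refine eLpNormEssSup_le_of_ae_bound ?_
  rw [ae_restrict_iUnion_iff]
  intro n
  filter_upwards [hlocal (τ n) (hτ n)] with p hp
  rwa [BerisEdwards.frobNorm, Real.norm_of_nonneg (Real.sqrt_nonneg _)]
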